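/- Let $\mathcal A$ be a nonempty finite set of real $n\times n$ matrices, let $\mathbb S$ be the Euclidean unit sphere of $\mathbb R^n$, let $\Delta=\mathcal A\times\mathbb S$, and let $\mathbb P$ be the uniform distribution on $\Delta$ (the product of the uniform distributions on $\mathcal A$ and on $\mathbb S$). Fix a real number $C\ge n$. For a finite set $\omega\subseteq\Delta$, consider the optimization problem $$\mathcal P_{\mathrm{jsr}}(\omega):\quad \min_{P=P^\top\in\mathbb R^{n\times n},\ \gamma\ge 0}\ (\gamma,\|P\|_F^2)\quad\text{s.t.}\quad P\succeq I,\ \ \|P\|_F\le C,\ \ (Ax)^\top P(Ax)\le\gamma^2x^\top Px\ \text{ for all }(A,x)\in\omega,$$ where the objective is minimized in the lexicographic order ($\gamma$ first) and $\|\cdot\|_F$ is the Frobenius norm. Let $\mathrm{Cost}_{\mathrm{jsr}}(\omega)\in\mathbb R^2$ be its optimal cost; costs are compared lexicographically. For $\bar\omega_N=(\delta_1,\dots,\delta_N)\in\Delta^N$ with $\omega_N=\{\delta_1,\dots,\delta_N\}$, define the violating probability $$V_{\mathrm{jsr}}(\bar\omega_N)=\mathbb P\bigl(\{\delta\in\Delta:\mathrm{Cost}_{\mathrm{jsr}}(\omega_N\cup\{\delta\})>\mathrm{Cost}_{\mathrm{jsr}}(\omega_N)\}\bigr).$$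 For $\varepsilon\in(0,1)$ and integers $0\le k\le N$, let $\Phi(\varepsilon,k,N)=\sum_{j=0}^{k}\binom Nj\varepsilon^j(1-\varepsilon)^{N-j}$; for $k<N$ this is the regularized incomplete beta function $I_{1-\varepsilon}(N-k,k+1)$. Assume that no matrix in $\mathcal A$ is Barabanov, i.e., there is no $A\in\mathcal A$ such that $A^\top PA=\gamma^2P$ for some symmetric $P\succ0$ and some $\gamma\ge0$. Let $d=\frac{n(n+1)}2$, let $N\in\mathbb N$ with $N\ge d$, and let $\varepsilon\in(0,1)$. Then $$\mathbb P^N\bigl(\{\bar\omega_N\in\Delta^N:V_{\mathrm{jsr}}(\bar\omega_N)>\varepsilon\}\bigr)\le\Phi(\varepsilon,d-1,N),$$ and this improves the bound $\Phi(\varepsilon,d,N)$ of Kenanian et al.: $\Phi(\varepsilon,d-1,N)<\Phi(\varepsilon,d,N)$. -/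

import Mathlib

open MeasureTheory ProbabilityTheory Matrix

namespace JSR

/-- A real square matrix `A` is Barabanov if `Aᵀ P A = γ² P` for some symmetric positive definite
matrix `P` and some `γ ≥ 0`. Over `ℝ`, `Matrix.PosDef` includes symmetry. -/
def IsBarabanov {n : ℕ} (A : Matrix (Fin n) (Fin n) ℝ) : Prop :=
  ∃ P : Matrix (Fin n) (Fin n) ℝ, P.PosDef ∧ ∃ γ : ℝ, 0 ≤ γ ∧ Aᵀ * P * A = γ ^ 2 • P

/-- The unit sphere of the Euclidean space `ℝⁿ`. -/
abbrev UnitSphere (n : ℕ) : Type := Metric.sphere (0 : EuclideanSpace ℝ (Fin n)) 1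

/-- The set of constraints `Δ = 𝒜 × 𝕊`. -/
abbrev Constraint {n : ℕ} (𝒜 : Finset (Matrix (Fin n) (Fin n) ℝ)) : Type :=
  {A : Matrix (Fin n) (Fin n) ℝ // A ∈ 𝒜} × UnitSphere n

/-- The finite set `𝒜` carries the discrete σ-algebra. -/
instance instMeasurableSpaceModes {n : ℕ} (𝒜 : Finset (Matrix (Fin n) (Fin n) ℝ)) :
    MeasurableSpace {A : Matrix (Fin n) (Fin n) ℝ // A ∈ 𝒜} := ⊤

instance instDiscreteMeasurableSpaceModes {n : ℕ} (𝒜 : Finset (Matrix (Fin n) (Fin n) ℝ)) :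
    DiscreteMeasurableSpace {A : Matrix (Fin n) (Fin n) ℝ // A ∈ 𝒜} := ⟨fun _ => trivial⟩

/-- The uniform distribution on the unit sphere: the surface measure, normalized to mass one. -/
noncomputable def sphereUniform (n : ℕ) : Measure (UnitSphere n) :=
  ProbabilityTheory.cond (volume : Measure (EuclideanSpace ℝ (Fin n))).toSphere Set.univ

/-- The uniform distribution `ℙ` on `Δ = 𝒜 × 𝕊`: the product of the uniform distributions. -/
noncomputable def uniformΔ {n : ℕ} (𝒜 : Finset (Matrix (Fin n) (Fin n) ℝ)) :
    Measure (Constraint 𝒜) :=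
  (uniformOn (Set.univ : Set {A : Matrix (Fin n) (Fin n) ℝ // A ∈ 𝒜})).prod (sphereUniform n)

section Problem

open scoped Matrix.Norms.Frobenius

/-- The common constraint: the symmetric matrices `P` with `P ⪰ I` and Frobenius norm at most
`C`. -/
def commonSet (n : ℕ) (C : ℝ) : Set (Matrix (Fin n) (Fin n) ℝ) :=
  {P | P.IsSymm ∧ (P - 1).PosSemidef ∧ ‖P‖ ≤ C}

/-- The feasible set of the sampled problem `P_jsr(ω)`: the pairs `(γ, P)` with `γ ≥ 0`, `P` in
the common set, and `(Ax)ᵀ P (Ax) ≤ γ² xᵀ P x` for all `(A, x) ∈ ω`. -/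
def feasible {n : ℕ} (𝒜 : Finset (Matrix (Fin n) (Fin n) ℝ)) (C : ℝ) (ω : Set (Constraint 𝒜)) :
    Set (ℝ × Matrix (Fin n) (Fin n) ℝ) :=
  {q | 0 ≤ q.1 ∧ q.2 ∈ commonSet n C ∧
    ∀ δ ∈ ω, (δ.1.1 *ᵥ δ.2.1.ofLp) ⬝ᵥ (q.2 *ᵥ (δ.1.1 *ᵥ δ.2.1.ofLp)) ≤
      q.1 ^ 2 * (δ.2.1.ofLp ⬝ᵥ (q.2 *ᵥ δ.2.1.ofLp))}

/-- The objective `(γ, ‖P‖_F²)`, in `ℝ × ℝ` with the lexicographic order. -/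
noncomputable def objective {n : ℕ} (q : ℝ × Matrix (Fin n) (Fin n) ℝ) : ℝ ×ₗ ℝ :=
  toLex (q.1, ‖q.2‖ ^ 2)

open Classical in
/-- The optimal cost of `P_jsr(ω)`: the lexicographically least value of the objective on the
feasible set. It exists for finite `ω` and `C ≥ n`, see `isLeast_cost`. -/
noncomputable def cost {n : ℕ} (𝒜 : Finset (Matrix (Fin n) (Fin n) ℝ)) (C : ℝ)
    (ω : Set (Constraint 𝒜)) : ℝ ×ₗ ℝ :=
  if h : ∃ c, IsLeast (objective '' feasible 𝒜 C ω) c then h.choose else toLex (0, 0)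

end Problem

/-- The violating probability
`V_jsr(ω̄) = ℙ {δ | Cost(ω ∪ {δ}) > Cost(ω)}` of a tuple `ω̄ = (δ₁, …, δ_N)`, where
`ω = {δ₁, …, δ_N}`. -/
noncomputable def violatingProb {n : ℕ} (𝒜 : Finset (Matrix (Fin n) (Fin n) ℝ)) (C : ℝ) {N : ℕ}
    (ω : Fin N → Constraint 𝒜) : ENNReal :=
  uniformΔ 𝒜 {δ | cost 𝒜 C (Set.range ω) < cost 𝒜 C (Set.range ω ∪ {δ})}

/-- `Φ(ε, k, N) = ∑_{j=0}^{k} (N choose j) ε^j (1-ε)^(N-j)`, the regularized incomplete beta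
function `I_{1-ε}(N-k, k+1)`, see `Phi_eq_regularizedIncompleteBeta`. -/
noncomputable def Phi (ε : ℝ) (k N : ℕ) : ℝ :=
  ∑ j ∈ Finset.range (k + 1), (N.choose j : ℝ) * ε ^ j * (1 - ε) ^ (N - j)

/-- The regularized incomplete beta function `I_x(a, b)`, for positive integers `a`, `b`. -/
noncomputable def regularizedIncompleteBeta (x : ℝ) (a b : ℕ) : ℝ :=
  (∫ t in (0 : ℝ)..x, t ^ (a - 1) * (1 - t) ^ (b - 1)) /
    ∫ t in (0 : ℝ)..1, t ^ (a - 1) * (1 - t) ^ (b - 1)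


/-- `ℙ` is a probability measure. -/
theorem isProbabilityMeasure_uniformΔ {n : ℕ} (hn : 1 ≤ n)
    (𝒜 : Finset (Matrix (Fin n) (Fin n) ℝ)) (h𝒜 : 𝒜.Nonempty) :
    IsProbabilityMeasure (uniformΔ 𝒜) := by
  have : Nonempty {A : Matrix (Fin n) (Fin n) ℝ // A ∈ 𝒜} := h𝒜.to_subtype
  have : Nonempty (Fin n) := ⟨⟨0, hn⟩⟩
  have h1 : IsProbabilityMeasure
      (uniformOn (Set.univ : Set {A : Matrix (Fin n) (Fin n) ℝ // A ∈ 𝒜})) :=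
    isProbabilityMeasure_uniformOn Set.finite_univ Set.univ_nonempty
  have h2 : IsProbabilityMeasure (sphereUniform n) := by
    refine cond_isProbabilityMeasure ?_
    rw [Ne, Measure.measure_univ_eq_zero]
    exact Measure.toSphere_ne_zero _
  unfold uniformΔ
  infer_instance

section Attained

open scoped Matrix.Norms.Frobenius

theorem isClosed_feasible {n : ℕ} (𝒜 : Finset (Matrix (Fin n) (Fin n) ℝ)) (C : ℝ)
    (ω : Set (Constraint 𝒜)) : IsClosed (feasible 𝒜 C ω) := by
  have hset : feasible 𝒜 C ω = {q | 0 ≤ q.1} ∩ ({q | q.2ᵀ = q.2} ∩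
      ({q | (q.2 - 1)ᴴ = q.2 - 1} ∩ (⋂ x : Fin n → ℝ, {q | 0 ≤ star x ⬝ᵥ ((q.2 - 1) *ᵥ x)})) ∩
      {q | ‖q.2‖ ≤ C}) ∩
      ⋂ δ ∈ ω, {q | (δ.1.1 *ᵥ δ.2.1.ofLp) ⬝ᵥ (q.2 *ᵥ (δ.1.1 *ᵥ δ.2.1.ofLp)) ≤
        q.1 ^ 2 * (δ.2.1.ofLp ⬝ᵥ (q.2 *ᵥ δ.2.1.ofLp))} := by
    ext q
    simp only [feasible, commonSet, Matrix.IsSymm, Matrix.posSemidef_iff_dotProduct_mulVec,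
      Matrix.IsHermitian, Set.mem_ofPred_eq, Set.mem_inter_iff, Set.mem_iInter]
    tauto
  rw [hset]
  refine ((isClosed_le continuous_const continuous_fst).inter
    (((isClosed_eq ?_ ?_).inter ((isClosed_eq ?_ ?_).inter (isClosed_iInter fun x =>
      isClosed_le continuous_const ?_))).inter (isClosed_le ?_ continuous_const))).inter
    (isClosed_biInter fun δ _ => isClosed_le ?_ ?_)
  all_goals fun_prop

/-- For finite `ω` and `C ≥ n`, the sampled problem has an optimal solution. -/
theorem isLeast_cost {n : ℕ} (𝒜 : Finset (Matrix (Fin n) (Fin n) ℝ)) (C : ℝ) (hC : (n : ℝ) ≤ C)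
    (ω : Set (Constraint 𝒜)) (hω : ω.Finite) :
    IsLeast (objective '' feasible 𝒜 C ω) (cost 𝒜 C ω) := by
  suffices h : ∃ c, IsLeast (objective '' feasible 𝒜 C ω) c by
    rw [cost, dif_pos h]
    exact h.choose_spec
  have hprop : ProperSpace (Matrix (Fin n) (Fin n) ℝ) := FiniteDimensional.proper ℝ _
  -- a feasible point
  obtain ⟨Γ, hΓ⟩ : ∃ Γ : ℝ, (Γ, (1 : Matrix (Fin n) (Fin n) ℝ)) ∈ feasible 𝒜 C ω := by
    obtain ⟨M, hM⟩ := (hω.image fun δ : Constraint 𝒜 =>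
      (δ.1.1 *ᵥ δ.2.1.ofLp) ⬝ᵥ (δ.1.1 *ᵥ δ.2.1.ofLp)).bddAbove
    refine ⟨√(max M 0), Real.sqrt_nonneg _, ⟨Matrix.isSymm_one, ?_, ?_⟩, fun δ hδ => ?_⟩
    · simpa using Matrix.PosSemidef.zero
    · refine le_trans ?_ hC
      rw [Matrix.frobenius_norm_def]
      have : (∑ i : Fin n, ∑ j : Fin n, ‖(1 : Matrix (Fin n) (Fin n) ℝ) i j‖ ^ (2 : ℝ)) = n := by
        simp [Matrix.one_apply, apply_ite]
      rw [this, ← Real.sqrt_eq_rpow]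
      refine Real.sqrt_le_iff.2 ⟨by positivity, ?_⟩
      exact_mod_cast Nat.le_self_pow two_ne_zero n
    · have h1 : δ.2.1.ofLp ⬝ᵥ δ.2.1.ofLp = 1 := by
        have h := δ.2.2
        rw [mem_sphere_zero_iff_norm, EuclideanSpace.norm_eq, Real.sqrt_eq_one] at h
        simpa [dotProduct, sq] using h
      simp only [Matrix.one_mulVec, h1, mul_one]
      rw [Real.sq_sqrt (le_max_right _ _)]
      exact (hM ⟨δ, hδ, rfl⟩).trans (le_max_left _ _)
  have hcl := isClosed_feasible 𝒜 C ω
  have hcomp : IsCompact (feasible 𝒜 C ω ∩ Set.Icc 0 Γ ×ˢ Metric.closedBall 0 C) :=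
    (isCompact_Icc.prod (isCompact_closedBall _ _)).inter_left hcl
  have hmem : ∀ q ∈ feasible 𝒜 C ω, q.1 ≤ Γ →
      q ∈ feasible 𝒜 C ω ∩ Set.Icc 0 Γ ×ˢ Metric.closedBall 0 C := fun q hq h =>
    ⟨hq, ⟨hq.1, h⟩, by simpa using hq.2.1.2.2⟩
  obtain ⟨q₀, hq₀, hmin₀⟩ := hcomp.exists_isMinOn ⟨_, hmem _ hΓ le_rfl⟩ continuous_fst.continuousOn
  have hcomp' : IsCompact ((feasible 𝒜 C ω ∩ Set.Icc 0 Γ ×ˢ Metric.closedBall 0 C) ∩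
      {q | q.1 = q₀.1}) := hcomp.inter_right (isClosed_eq continuous_fst continuous_const)
  obtain ⟨q₁, hq₁, hmin₁⟩ := hcomp'.exists_isMinOn ⟨q₀, hq₀, rfl⟩
    (f := fun q => ‖q.2‖ ^ 2) (by fun_prop)
  refine ⟨objective q₁, ⟨q₁, hq₁.1.1, rfl⟩, ?_⟩
  rintro _ ⟨q, hq, rfl⟩
  have h1 : q₁.1 = q₀.1 := hq₁.2
  have hle : q₀.1 ≤ q.1 := by
    by_cases h : q.1 ≤ Γ
    · exact hmin₀ (hmem q hq h)
    · exact hq₀.2.1.2.trans (not_le.1 h).le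
  rw [objective, objective, Prod.Lex.toLex_le_toLex]
  rcases hle.lt_or_eq with h | h
  · exact Or.inl (by simpa [h1] using h)
  · refine Or.inr ⟨by simp [h1, h], ?_⟩
    exact hmin₁ ⟨hmem q hq (h ▸ hq₀.2.1.2), h.symm⟩

end Attained

theorem hasDerivAt_Phi (k N : ℕ) (hk : k < N) (x : ℝ) :
    HasDerivAt (fun y => Phi (1 - y) k N)
      ((N - k : ℕ) * (N.choose k : ℝ) * (x ^ (N - k - 1) * (1 - x) ^ k)) x := by
  have hterm : ∀ j : ℕ, HasDerivAt
      (fun y : ℝ => (N.choose j : ℝ) * (1 - y) ^ j * (1 - (1 - y)) ^ (N - j))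
      ((N.choose j : ℝ) * ((N - j : ℕ) * x ^ (N - j - 1) * (1 - x) ^ j
        - j * (1 - x) ^ (j - 1) * x ^ (N - j))) x := by
    intro j
    have h1 : HasDerivAt (fun y : ℝ => 1 - y) (-1) x := by
      simpa using (hasDerivAt_id x).const_sub 1
    have h2 := ((h1.fun_pow j).const_mul (N.choose j : ℝ)).fun_mul (hasDerivAt_pow (N - j) x)
    simp only [sub_sub_cancel]
    refine h2.congr_deriv ?_
    ring
  induction k with
  | zero =>
    have := hterm 0
    simp only [Phi, zero_add, Finset.range_one, Finset.sum_singleton]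
    refine this.congr_deriv ?_
    simp
  | succ k ih =>
    have ih := ih (by omega)
    have hsucc : (fun y => Phi (1 - y) (k + 1) N) = fun y => Phi (1 - y) k N +
        (N.choose (k + 1) : ℝ) * (1 - y) ^ (k + 1) * (1 - (1 - y)) ^ (N - (k + 1)) := by
      funext y
      simp only [Phi]
      rw [Finset.sum_range_succ]
    rw [hsucc]
    refine (ih.fun_add (hterm (k + 1))).congr_deriv ?_
    have hch : (N.choose (k + 1) : ℝ) * ((k + 1 : ℕ) : ℝ) = N.choose k * (N - k : ℕ) := by
      exact_mod_cast Nat.choose_succ_right_eq N k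
    have e : N - (k + 1) = N - k - 1 := by omega
    rw [Nat.add_sub_cancel, e]
    linear_combination (-(1 - x) ^ k * x ^ (N - k - 1)) * hch

/-- `Φ(ε, k, N) = I_{1-ε}(N-k, k+1)` for `k < N`. -/
theorem Phi_eq_regularizedIncompleteBeta (ε : ℝ) (k N : ℕ) (hk : k < N) :
    Phi ε k N = regularizedIncompleteBeta (1 - ε) (N - k) (k + 1) := by
  have key : ∀ x : ℝ, ((N - k : ℕ) * (N.choose k : ℝ)) *
      (∫ t in (0 : ℝ)..x, t ^ (N - k - 1) * (1 - t) ^ k) = Phi (1 - x) k N := by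
    intro x
    have h := intervalIntegral.integral_eq_sub_of_hasDerivAt
      (fun y _ => hasDerivAt_Phi k N hk y) (a := 0) (b := x)
      (Continuous.intervalIntegrable (by fun_prop) _ _)
    rw [intervalIntegral.integral_const_mul] at h
    have h0 : Phi (1 - 0) k N = 0 := by
      refine Finset.sum_eq_zero fun j hj => ?_
      have : N - j ≠ 0 := by have := Finset.mem_range.1 hj; omega
      simp [this]
    rw [h, h0, sub_zero]
  have h1 : Phi (1 - 1) k N = 1 := by
    rw [Phi, Finset.sum_range_succ']
    simp
  have hx := key (1 - ε)
  have hone := key 1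
  rw [h1] at hone
  rw [sub_sub_cancel] at hx
  rw [regularizedIncompleteBeta, Nat.add_sub_cancel, ← hx]
  have hne : (∫ t in (0 : ℝ)..1, t ^ (N - k - 1) * (1 - t) ^ k) ≠ 0 := by
    intro h
    rw [h, mul_zero] at hone
    exact zero_ne_one hone
  rw [eq_div_iff hne]
  linear_combination (∫ t in (0 : ℝ)..(1 - ε), t ^ (N - k - 1) * (1 - t) ^ k) * hone

end JSR

/-!
The bound holds because, in general position, the optimal solution is determined by at most
`d = n(n+1)/2` of the sampled constraints, and by one `d`-element set of them that can be chosen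
canonically.

*Dimension.* The problem has `d + 1` variables `γ`, `P`, but the constraints are homogeneous in `P`.
Write `(γ*, P*)` for the optimal solution. Up to scaling, the matrices that improve on it for a
single constraint form a convex cone (`improvingCone`) in the `d`-dimensional space of symmetric
matrices: the constraint holds at `γ*`, and either it holds strictly, so that `γ` can be decreased,
or the norm is smaller than that of `P*`. A common point of all these cones contradicts optimality.
Helly's theorem on the hyperplane section by the trace (`helly_cone`) therefore gives at most `d`
constraints with the same optimal solution (`IsSol.exists_basis`).

*General position.* The optimal solution is unique (`IsSol.unique`), it depends measurably on the
sample, and removing inactive constraints does not change it (`IsSol.of_inactive`). As no matrix is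
Barabanov, `Aᵀ P A - γ² P` is a nonzero quadratic form for every `A`, so that a fresh constraint is
almost surely not active at a given point (`uniformΔ_residual_eq_zero`). Hence almost surely the
active constraints at the optimum belong to every set as above; there are at most `d` of them, and
they determine the optimum. They are completed to a set of exactly `d` elements by the inactive
constraints with the smallest tags, where the tag is an atomless function of the constraint, the
square of a coordinate of the point of the sphere. The result is the unique `d`-subset of the
sample which no other element of the sample disturbs (`selected_unique`, `exists_selected`).

*Probability.* Let `p` be the probability that a fresh element does not disturb `d` given ones.
Exactly one of the `N.choose d` subsets is undisturbed, hence `𝔼[p ^ (N - d)] = 1 / N.choose d` for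
all `N ≥ d`. These moments determine the law of `p`: it has density `d (1 - x)^(d-1)` on `[0, 1]`
(`map_prob_eq_probLaw`). The probability that the undisturbed subset has `1 - p > ε` is then an
incomplete beta integral, equal to `Φ(ε, d-1, N)` (`measure_selected_violation_le`). Finally, a
constraint that raises the optimal cost disturbs the undisturbed subset
(`violatingProb_le_of_selected`).
-/

namespace JSR

/-! ### Samples with exactly one selected subset of fixed size -/

section Scenario

variable {X : Type*} [MeasurableSpace X]

/-- Splitting an independent sample into two complementary parts yields independent parts. -/
theorem measurePreserving_split {ι κ τ : Type*} [Fintype ι] [Fintype κ] [Fintype τ]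
    (μ : Measure X) [SigmaFinite μ] (e : ι ⊕ κ ≃ τ) :
    MeasurePreserving (fun ω : τ → X => (fun i => ω (e (Sum.inl i)), fun k => ω (e (Sum.inr k))))
      (Measure.pi fun _ => μ) ((Measure.pi fun _ => μ).prod (Measure.pi fun _ => μ)) :=
  (measurePreserving_sumPiEquivProdPi fun _ => μ).comp
    (measurePreserving_piCongrLeft (fun _ => μ) e).symm

theorem measurePreserving_pair {ι τ : Type*} [Fintype ι] [Fintype τ]
    (μ : Measure X) [IsProbabilityMeasure μ] (f : ι ↪ τ) (j : τ) (hj : j ∉ Set.range f) :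
    MeasurePreserving (fun ω : τ → X => (fun i => ω (f i), ω j))
      (Measure.pi fun _ => μ) ((Measure.pi fun _ => μ).prod μ) := by
  classical
  have h1 := measurePreserving_split μ ((Equiv.sumCongr (Equiv.ofInjective f f.injective)
    (Equiv.refl _)).trans (Equiv.sumCompl fun a => a ∈ Set.range f))
  exact ((MeasurePreserving.id _).prod (measurePreserving_eval (fun _ => μ) ⟨j, hj⟩)).comp h1

theorem pi_measure_split {ι κ τ : Type*} [Fintype ι] [Fintype κ] [Fintype τ]
    (μ : Measure X) [IsProbabilityMeasure μ] (e : ι ⊕ κ ≃ τ) {S : Set (ι → X)}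
    (hS : MeasurableSet S) {G : Set ((ι → X) × X)} (hG : MeasurableSet G) :
    (Measure.pi fun _ : τ => μ) {ω | (fun i => ω (e (Sum.inl i))) ∈ S ∧
        ∀ k, ((fun i => ω (e (Sum.inl i))), ω (e (Sum.inr k))) ∈ G} =
      ∫⁻ b in S, μ {x | (b, x) ∈ G} ^ Fintype.card κ ∂(Measure.pi fun _ : ι => μ) := by
  have hT : MeasurableSet
      {q : (ι → X) × (κ → X) | q.1 ∈ S ∧ ∀ k, (q.1, q.2 k) ∈ G} := by
    have h : MeasurableSet (⋂ k, {q : (ι → X) × (κ → X) | (q.1, q.2 k) ∈ G}) :=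
      MeasurableSet.iInter fun k => (by fun_prop :
        Measurable fun q : (ι → X) × (κ → X) => (q.1, q.2 k)) hG
    convert (measurable_fst hS).inter h using 1
    ext q; simp
  rw [← lintegral_indicator hS]
  refine ((measurePreserving_split μ e).measure_preimage hT.nullMeasurableSet).trans ?_
  rw [Measure.prod_apply hT]
  congr 1
  funext b
  by_cases hb : b ∈ S
  · have : Prod.mk b ⁻¹' {q : (ι → X) × (κ → X) | q.1 ∈ S ∧ ∀ k, (q.1, q.2 k) ∈ G} =
        Set.univ.pi fun _ => {x | (b, x) ∈ G} := by
      ext y; simp [hb]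
    rw [this, Measure.pi_pi, Set.indicator_of_mem hb]
    simp
  · simp [hb]

/-- A finite measure on `[0, 1]` is determined by its moments, since polynomials are dense. -/
theorem measure_eq_of_moments {ν β : Measure ℝ} [IsFiniteMeasure ν] [IsFiniteMeasure β]
    (hν : ∀ᵐ x ∂ν, x ∈ Set.Icc (0 : ℝ) 1) (hβ : ∀ᵐ x ∂β, x ∈ Set.Icc (0 : ℝ) 1)
    (h : ∀ m : ℕ, ∫ x, x ^ m ∂ν = ∫ x, x ^ m ∂β) : ν = β := by
  have hint : ∀ {ρ : Measure ℝ} [IsFiniteMeasure ρ], (∀ᵐ x ∂ρ, x ∈ Set.Icc (0 : ℝ) 1) →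
      ∀ p : Polynomial ℝ, Integrable (fun x => p.eval x) ρ := by
    intro ρ _ hρ p
    obtain ⟨M, hM⟩ := isCompact_Icc.exists_bound_of_continuousOn
      (f := fun x : ℝ => p.eval x) (s := Set.Icc 0 1) p.continuous.continuousOn
    exact Integrable.of_bound p.continuous.aestronglyMeasurable M (hρ.mono hM)
  have hpoly : ∀ p : Polynomial ℝ, ∫ x, p.eval x ∂ν = ∫ x, p.eval x ∂β := by
    intro p
    have hmono : ∀ {ρ : Measure ℝ} [IsFiniteMeasure ρ], (∀ᵐ x ∂ρ, x ∈ Set.Icc (0 : ℝ) 1) →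
        ∀ m : ℕ, Integrable (fun x : ℝ => x ^ m) ρ := by
      intro ρ _ hρ m
      simpa using hint hρ (Polynomial.X ^ m)
    simp only [Polynomial.eval_eq_sum_range]
    rw [integral_finsetSum _ fun i _ => (hmono hν i).const_mul _,
      integral_finsetSum _ fun i _ => (hmono hβ i).const_mul _]
    simp only [integral_const_mul, h]
  refine ext_of_forall_integral_eq_of_IsFiniteMeasure fun f => ?_
  have hf : ∀ {ρ : Measure ℝ} [IsFiniteMeasure ρ], Integrable f ρ := fun {ρ} _ => f.integrable ρ
  refine eq_of_forall_dist_le fun ε hε => ?_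
  -- approximate `f` by a polynomial within `ε / c`, where `c` exceeds the total mass of `ν` and `β`
  set c := ν.real Set.univ + β.real Set.univ + 1
  have hc : 0 < c := by positivity
  obtain ⟨p, hp⟩ := exists_polynomial_near_of_continuousOn 0 1 f f.continuous.continuousOn (ε / c)
    (by positivity)
  have hb : ∀ {ρ : Measure ℝ} [IsFiniteMeasure ρ], (∀ᵐ x ∂ρ, x ∈ Set.Icc (0 : ℝ) 1) →
      |∫ x, p.eval x ∂ρ - ∫ x, f x ∂ρ| ≤ ε / c * ρ.real Set.univ := by
    intro ρ _ hρ
    rw [← integral_sub (hint hρ p) hf, ← Real.norm_eq_abs]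
    exact norm_integral_le_of_norm_le_const (hρ.mono fun x hx => (hp x hx).le)
  have h1 := hb hν
  have h2 := hb hβ
  rw [hpoly p] at h1
  rw [Real.dist_eq]
  have h3 : |∫ x, f x ∂ν - ∫ x, f x ∂β| ≤ ε / c * (ν.real Set.univ + β.real Set.univ) := by
    rw [abs_le] at *
    constructor <;> linarith [h1.1, h1.2, h2.1, h2.2]
  refine h3.trans ?_
  rw [div_mul_eq_mul_div, div_le_iff₀ hc]
  gcongr
  simp [c]

/-- The distribution on `[0, 1]` with density `d (1 - x)^(d-1)`, that is, the beta distribution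
with parameters `1` and `d`. -/
noncomputable def probLaw (d : ℕ) : Measure ℝ :=
  (volume.restrict (Set.Ioc (0 : ℝ) 1)).withDensity
    fun x => ENNReal.ofReal (d * (1 - x) ^ (d - 1))

/-- The truncated moments of `probLaw d` are values of `Φ`, since `Φ(1 - y, k, N)` is an
antiderivative of a multiple of `y^(N-k-1) (1-y)^k`. -/
theorem setLIntegral_probLaw {d : ℕ} (hd : 1 ≤ d) (m : ℕ) {y : ℝ} (hy₀ : 0 ≤ y) (hy₁ : y ≤ 1) :
    ((m + d).choose d : ENNReal) * ∫⁻ x in Set.Iic y, ENNReal.ofReal x ^ m ∂(probLaw d) =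
      ENNReal.ofReal (Phi (1 - y) (d - 1) (m + d)) := by
  have hmeas : Measurable fun x : ℝ => ENNReal.ofReal (d * (1 - x) ^ (d - 1)) := by fun_prop
  have hN : m + d - (d - 1) = m + 1 := by omega
  have hch : ((m + d).choose d : ℝ) * d = (m + 1 : ℕ) * ((m + d).choose (d - 1)) := by
    have := Nat.choose_succ_right_eq (m + d) (d - 1)
    rw [hN, Nat.sub_add_cancel hd] at this
    rw [mul_comm ((m + 1 : ℕ) : ℝ)]
    exact_mod_cast this
  have hder : ∀ x : ℝ, HasDerivAt (fun y => Phi (1 - y) (d - 1) (m + d))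
      (((m + d).choose d : ℝ) * (x ^ m * (d * (1 - x) ^ (d - 1)))) x := by
    intro x
    have := hasDerivAt_Phi (d - 1) (m + d) (by omega) x
    rw [hN, Nat.add_sub_cancel, ← hch] at this
    exact this.congr_deriv (by ring)
  have hFTC := intervalIntegral.integral_eq_sub_of_hasDerivAt (fun x _ => hder x) (a := 0) (b := y)
    (Continuous.intervalIntegrable (by fun_prop) _ _)
  have h0 : Phi (1 - 0) (d - 1) (m + d) = 0 := by
    refine Finset.sum_eq_zero fun j hj => ?_
    have : m + d - j ≠ 0 := by have := Finset.mem_range.1 hj; omega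
    simp [this]
  rw [h0, sub_zero, intervalIntegral.integral_of_le hy₀] at hFTC
  rw [probLaw, setLIntegral_withDensity_eq_setLIntegral_mul _ hmeas (by fun_prop)
    measurableSet_Iic, Measure.restrict_restrict measurableSet_Iic, Set.inter_comm,
    Set.Ioc_inter_Iic, min_eq_right hy₁, ← hFTC, ofReal_integral_eq_lintegral_ofReal,
    ← lintegral_const_mul _ (by fun_prop)]
  · refine setLIntegral_congr_fun measurableSet_Ioc fun x hx => ?_
    have hx1 : 0 ≤ 1 - x := by linarith [hx.2]
    simp only [Pi.mul_apply]
    rw [ENNReal.ofReal_mul (p := ((m + d).choose d : ℝ)) (by positivity),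
      ENNReal.ofReal_mul (p := x ^ m) (pow_nonneg hx.1.le _),
      ENNReal.ofReal_natCast, ENNReal.ofReal_pow hx.1.le]
    ring
  · exact (Continuous.integrableOn_Icc (by fun_prop)).mono_set Set.Ioc_subset_Icc_self
  · refine (ae_restrict_iff' measurableSet_Ioc).2 (Filter.Eventually.of_forall fun x hx => ?_)
    have hx1 : 0 ≤ 1 - x := by linarith [hx.2]
    have hx0 := hx.1.le
    simp only [Pi.zero_apply]
    positivity

theorem ae_probLaw_mem (d : ℕ) : ∀ᵐ x ∂(probLaw d), x ∈ Set.Icc (0 : ℝ) 1 :=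
  (withDensity_absolutelyContinuous _ _).ae_le
    ((ae_restrict_mem measurableSet_Ioc).mono fun _ hx => Set.Ioc_subset_Icc_self hx)

theorem Phi_zero (k N : ℕ) : Phi 0 k N = 1 := by
  rw [Phi, Finset.sum_range_succ']
  simp

theorem lintegral_pow_probLaw {d : ℕ} (hd : 1 ≤ d) (m : ℕ) :
    ((m + d).choose d : ENNReal) * ∫⁻ x, ENNReal.ofReal x ^ m ∂(probLaw d) = 1 := by
  have h := setLIntegral_probLaw hd m zero_le_one le_rfl
  rw [sub_self, Phi_zero, ENNReal.ofReal_one] at h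
  rw [← h, Measure.restrict_eq_self_of_ae_mem]
  exact (ae_probLaw_mem d).mono fun x hx => hx.2

/-- The elements with index in the `d`-element set `I`, listed in increasing order, are selected by
`G` from the sample `ω`: every other element of the sample is in relation `G` to the tuple `ω`
restricted to `I`. -/
def Selected {d N : ℕ} (G : Set ((Fin d → X) × X)) (ω : Fin N → X) (I : Finset (Fin N))
    (hI : I.card = d) : Prop :=
  ∀ j ∉ I, (ω ∘ I.orderEmbOfFin hI, ω j) ∈ G

theorem measure_selected (μ : Measure X) [IsProbabilityMeasure μ] {d N : ℕ}
    {G : Set ((Fin d → X) × X)} (hG : MeasurableSet G) {S : Set (Fin d → X)} (hS : MeasurableSet S)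
    (I : Finset (Fin N)) (hI : I.card = d) :
    (Measure.pi fun _ : Fin N => μ) {ω | ω ∘ I.orderEmbOfFin hI ∈ S ∧ Selected G ω I hI} =
      ∫⁻ b in S, μ {x | (b, x) ∈ G} ^ (N - d) ∂(Measure.pi fun _ : Fin d => μ) := by
  classical
  have h := pi_measure_split μ ((Equiv.sumCongr (I.orderIsoOfFin hI).toEquiv
    (Equiv.refl _)).trans (Equiv.sumCompl fun a => a ∈ I)) hS hG
  have hcard : Fintype.card {a // a ∉ I} = N - d := by
    rw [Fintype.card_subtype_compl]; simp [hI]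
  rw [hcard] at h
  rw [← h]
  congr 1
  ext ω
  constructor
  · exact fun h => ⟨h.1, fun k => h.2 k.1 k.2⟩
  · exact fun h => ⟨h.1, fun j hj => h.2 ⟨j, hj⟩⟩

theorem measurableSet_selected {d N : ℕ}
    {G : Set ((Fin d → X) × X)} (hG : MeasurableSet G) {S : Set (Fin d → X)} (hS : MeasurableSet S)
    (I : Finset (Fin N)) (hI : I.card = d) :
    MeasurableSet {ω : Fin N → X | ω ∘ I.orderEmbOfFin hI ∈ S ∧ Selected G ω I hI} := by
  have hm : Measurable fun ω : Fin N → X => ω ∘ I.orderEmbOfFin hI :=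
    measurable_pi_lambda _ fun i => measurable_pi_apply _
  have h : MeasurableSet (⋂ j, ⋂ _ : j ∉ I,
      {ω : Fin N → X | (ω ∘ I.orderEmbOfFin hI, ω j) ∈ G}) :=
    MeasurableSet.iInter fun j => MeasurableSet.iInter fun _ =>
      (hm.prodMk (measurable_pi_apply j)) hG
  convert (hm hS).inter h using 1
  ext ω; simp [Selected]

theorem measure_exists_selected (μ : Measure X) [IsProbabilityMeasure μ] {d N : ℕ}
    {G : Set ((Fin d → X) × X)} (hG : MeasurableSet G) {S : Set (Fin d → X)} (hS : MeasurableSet S)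
    (huniq : ∀ (ω : Fin N → X) (I J : Finset (Fin N)) (hI : I.card = d) (hJ : J.card = d),
      Selected G ω I hI → Selected G ω J hJ → I = J) :
    (Measure.pi fun _ : Fin N => μ)
        {ω | ∃ I, ∃ hI : I.card = d, ω ∘ I.orderEmbOfFin hI ∈ S ∧ Selected G ω I hI} =
      (N.choose d : ENNReal) *
        ∫⁻ b in S, μ {x | (b, x) ∈ G} ^ (N - d) ∂(Measure.pi fun _ : Fin d => μ) := by
  have hset : {ω : Fin N → X | ∃ I, ∃ hI : I.card = d,
        ω ∘ I.orderEmbOfFin hI ∈ S ∧ Selected G ω I hI} =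
      ⋃ I : {I : Finset (Fin N) // I.card = d},
        {ω | ω ∘ I.1.orderEmbOfFin I.2 ∈ S ∧ Selected G ω I.1 I.2} := by
    ext ω; simp
  rw [hset, measure_iUnion]
  · simp only [measure_selected μ hG hS]
    rw [tsum_fintype, Finset.sum_const, Finset.card_univ, Fintype.card_finset_len, Fintype.card_fin,
      nsmul_eq_mul]
  · intro I J hIJ
    refine Set.disjoint_left.2 fun ω h1 h2 => hIJ (Subtype.ext ?_)
    exact huniq ω _ _ I.2 J.2 h1.2 h2.2
  · exact fun I => measurableSet_selected hG hS I.1 I.2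

/-- The law of the probability of `G`-sections is forced by its moments: since almost surely
exactly one of the `(m+d choose d)` subsets of a sample of size `m + d` is selected, the `m`-th
moment is the inverse of this binomial coefficient. -/
theorem map_prob_eq_probLaw (μ : Measure X) [IsProbabilityMeasure μ] {d : ℕ} (hd : 1 ≤ d)
    {G : Set ((Fin d → X) × X)} (hG : MeasurableSet G)
    (huniq : ∀ (N : ℕ) (ω : Fin N → X) (I J : Finset (Fin N)) (hI : I.card = d) (hJ : J.card = d),
      Selected G ω I hI → Selected G ω J hJ → I = J)
    (hex : ∀ N, d ≤ N → ∀ᵐ ω ∂(Measure.pi fun _ : Fin N => μ),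
      ∃ I, ∃ hI : I.card = d, Selected G ω I hI) :
    (Measure.pi fun _ : Fin d => μ).map (fun b => μ.real {x | (b, x) ∈ G}) = probLaw d := by
  have hm : Measurable fun b => μ.real {x | (b, x) ∈ G} :=
    (measurable_measure_prodMk_left hG).ennreal_toReal
  have hν : ∀ᵐ x ∂((Measure.pi fun _ : Fin d => μ).map fun b => μ.real {x | (b, x) ∈ G}),
      x ∈ Set.Icc (0 : ℝ) 1 := by
    refine (ae_map_iff hm.aemeasurable (p := fun x => x ∈ Set.Icc (0 : ℝ) 1) measurableSet_Icc).2
      ?_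
    exact Filter.Eventually.of_forall fun b => ⟨measureReal_nonneg, measureReal_le_one⟩
  have hfin : IsFiniteMeasure (probLaw d) := by
    refine ⟨?_⟩
    have := lintegral_pow_probLaw hd 0
    simp only [zero_add, Nat.choose_self, Nat.cast_one, one_mul, pow_zero, lintegral_one] at this
    simp [this]
  have := Measure.isProbabilityMeasure_map (μ := Measure.pi fun _ : Fin d => μ) hm.aemeasurable
  refine measure_eq_of_moments hν (ae_probLaw_mem d) fun m => ?_
  have key : ∀ ρ : Measure ℝ, (∀ᵐ x ∂ρ, x ∈ Set.Icc (0 : ℝ) 1) →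
      ∫ x, x ^ m ∂ρ = (∫⁻ x, ENNReal.ofReal x ^ m ∂ρ).toReal := by
    intro ρ hρ
    rw [integral_eq_lintegral_of_nonneg_ae (hρ.mono fun x hx => pow_nonneg hx.1 m) (by fun_prop)]
    congr 1
    exact lintegral_congr_ae (hρ.mono fun x hx => ENNReal.ofReal_pow hx.1 m)
  rw [key _ hν, key _ (ae_probLaw_mem d)]
  congr 1
  have h0 : ((m + d).choose d : ENNReal) ≠ 0 := by
    exact_mod_cast (Nat.choose_pos (Nat.le_add_left d m)).ne'
  refine (ENNReal.mul_right_inj h0 (ENNReal.natCast_ne_top _)).1 ?_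
  rw [lintegral_pow_probLaw hd m, lintegral_map (by fun_prop) hm]
  have h := measure_exists_selected (N := m + d) μ hG MeasurableSet.univ (huniq _)
  simp only [Set.mem_univ, true_and, Measure.restrict_univ, Nat.add_sub_cancel] at h
  have hof : ∀ b, ENNReal.ofReal (μ.real {x | (b, x) ∈ G}) = μ {x | (b, x) ∈ G} :=
    fun b => ofReal_measureReal
  simp only [hof]
  rw [← h, ← prob_compl_eq_zero_iff₀]
  · exact hex (m + d) (Nat.le_add_left d m)
  · refine MeasurableSet.nullMeasurableSet ?_
    have := MeasurableSet.iUnion fun I : {I : Finset (Fin (m + d)) // I.card = d} =>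
      measurableSet_selected hG MeasurableSet.univ I.1 I.2
    convert this using 1
    ext ω; simp

/-- If almost surely exactly one `d`-subset of every sample is selected by `G`, then the
probability that a new element fails to be in relation `G` to the selected tuple exceeds `ε` with
probability at most `Φ(ε, d-1, N)`. -/
theorem measure_selected_violation_le (μ : Measure X) [IsProbabilityMeasure μ] {d : ℕ} (hd : 1 ≤ d)
    {G : Set ((Fin d → X) × X)} (hG : MeasurableSet G)
    (huniq : ∀ (N : ℕ) (ω : Fin N → X) (I J : Finset (Fin N)) (hI : I.card = d) (hJ : J.card = d),
      Selected G ω I hI → Selected G ω J hJ → I = J)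
    (hex : ∀ N, d ≤ N → ∀ᵐ ω ∂(Measure.pi fun _ : Fin N => μ),
      ∃ I, ∃ hI : I.card = d, Selected G ω I hI)
    {N : ℕ} (hN : d ≤ N) {ε : ℝ} (hε₀ : 0 < ε) (hε₁ : ε < 1) :
    (Measure.pi fun _ : Fin N => μ) {ω | ∃ I, ∃ hI : I.card = d, Selected G ω I hI ∧
        ENNReal.ofReal ε < μ {x | (ω ∘ I.orderEmbOfFin hI, x) ∉ G}} ≤
      ENNReal.ofReal (Phi ε (d - 1) N) := by
  have hm : Measurable fun b => μ.real {x | (b, x) ∈ G} :=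
    (measurable_measure_prodMk_left hG).ennreal_toReal
  have hS : MeasurableSet {b | μ.real {x | (b, x) ∈ G} ≤ 1 - ε} := measurableSet_le hm (by fun_prop)
  obtain ⟨m, rfl⟩ := Nat.exists_eq_add_of_le' hN
  calc _ ≤ (Measure.pi fun _ : Fin (m + d) => μ)
        {ω | ∃ I, ∃ hI : I.card = d, ω ∘ I.orderEmbOfFin hI ∈
          {b | μ.real {x | (b, x) ∈ G} ≤ 1 - ε} ∧ Selected G ω I hI} := by
        refine measure_mono ?_
        rintro ω ⟨I, hI, h1, h2⟩
        refine ⟨I, hI, ?_, h1⟩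
        have hGm : MeasurableSet {x | (ω ∘ I.orderEmbOfFin hI, x) ∈ G} := measurable_prodMk_left hG
        have h3 : {x | (ω ∘ I.orderEmbOfFin hI, x) ∉ G} =
          {x | (ω ∘ I.orderEmbOfFin hI, x) ∈ G}ᶜ := rfl
        rw [h3, ← ofReal_measureReal, probReal_compl_eq_one_sub hGm] at h2
        have h4 := (ENNReal.ofReal_lt_ofReal_iff_of_nonneg hε₀.le).1 h2
        change μ.real {x | (ω ∘ I.orderEmbOfFin hI, x) ∈ G} ≤ 1 - ε
        linarith
    _ = _ := measure_exists_selected μ hG hS (huniq _)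
    _ = ENNReal.ofReal (Phi ε (d - 1) (m + d)) := by
        have h := setLIntegral_probLaw hd m (y := 1 - ε) (by linarith) (by linarith)
        rw [sub_sub_cancel, ← map_prob_eq_probLaw μ hd hG huniq hex,
          setLIntegral_map measurableSet_Iic (by fun_prop) hm] at h
        have hof : ∀ b, ENNReal.ofReal (μ.real {x | (b, x) ∈ G}) = μ {x | (b, x) ∈ G} :=
          fun b => ofReal_measureReal
        simp only [hof] at h
        rw [← h, Nat.add_sub_cancel]
        rfl

end Scenario

/-! ### Helly's theorem for cones -/

/-- **Helly's theorem** for convex cones: on a hyperplane section, the dimension drops by one. -/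
theorem helly_cone {V ι : Type*} [AddCommGroup V] [Module ℝ V] [FiniteDimensional ℝ V]
    {ℓ : V →ₗ[ℝ] ℝ} (hℓ : ℓ ≠ 0) (s : Finset ι) (F : ι → Set V)
    (hadd : ∀ i, ∀ x ∈ F i, ∀ y ∈ F i, x + y ∈ F i)
    (hsmul : ∀ i, ∀ x ∈ F i, ∀ a : ℝ, 0 < a → a • x ∈ F i)
    (hpos : ∀ i, ∀ x ∈ F i, 0 < ℓ x)
    (hI : ∀ I ⊆ s, I.card ≤ Module.finrank ℝ V → ∃ x, ∀ i ∈ I, x ∈ F i) :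
    ∃ x, ∀ i ∈ s, x ∈ F i := by
  obtain ⟨e, he⟩ : ∃ e, ℓ e = 1 := by
    obtain ⟨v, hv⟩ := DFunLike.ne_iff.1 hℓ
    exact ⟨(ℓ v)⁻¹ • v, by simpa using inv_mul_cancel₀ hv⟩
  have hrank := Module.Dual.finrank_ker_add_one_of_ne_zero hℓ
  have h := Convex.helly_theorem' (𝕜 := ℝ) (E := LinearMap.ker ℓ) (s := s)
    (F := fun i => {k | e + (k : V) ∈ F i}) ?_ ?_
  · obtain ⟨k, hk⟩ := h
    refine ⟨e + k, fun i hi => ?_⟩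
    simp only [Set.mem_iInter] at hk
    exact hk i hi
  · intro i _ x hx y hy a b ha hb hab
    rcases ha.eq_or_lt with rfl | ha
    · obtain rfl : b = 1 := by linarith
      simpa using hy
    rcases hb.eq_or_lt with rfl | hb
    · obtain rfl : a = 1 := by linarith
      simpa using hx
    have h1 := hadd i _ (hsmul i _ hx a ha) _ (hsmul i _ hy b hb)
    have h2 : e + ((a • x + b • y : LinearMap.ker ℓ) : V) = a • (e + x) + b • (e + y) := by
      have : e = a • e + b • e := by rw [← add_smul, hab, one_smul]
      simp only [Submodule.coe_add, Submodule.coe_smul, smul_add]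
      nth_rewrite 1 [this]
      abel
    change e + ((a • x + b • y : LinearMap.ker ℓ) : V) ∈ F i
    rwa [h2]
  · intro I hIs hcard
    obtain ⟨x, hx⟩ := hI I hIs (hcard.trans hrank.le)
    rcases I.eq_empty_or_nonempty with rfl | ⟨i, hi⟩
    · simp
    have hpx := hpos i x (hx i hi)
    refine ⟨⟨(ℓ x)⁻¹ • x - e, ?_⟩, ?_⟩
    · simp [LinearMap.mem_ker, he, inv_mul_cancel₀ hpx.ne']
    · simp only [Set.mem_iInter]
      intro j hj
      change e + ((ℓ x)⁻¹ • x - e) ∈ F j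
      rw [add_sub_cancel]
      exact hsmul j x (hx j hj) _ (inv_pos.2 hpx)

/-! ### Optimal solutions of the sampled problem -/

section Program

open scoped Matrix.Norms.Frobenius

variable {n : ℕ} {𝒜 : Finset (Matrix (Fin n) (Fin n) ℝ)} {C : ℝ}

/-- The function `(Ax)ᵀ P (Ax) - γ² xᵀ P x` of the constraint `δ = (A, x)`. The constraint is
satisfied by `(γ, P)` if it is nonpositive, and active if it vanishes. -/
def residual (δ : Constraint 𝒜) (γ : ℝ) (P : Matrix (Fin n) (Fin n) ℝ) : ℝ :=
  (δ.1.1 *ᵥ δ.2.1.ofLp) ⬝ᵥ (P *ᵥ (δ.1.1 *ᵥ δ.2.1.ofLp)) -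
    γ ^ 2 * (δ.2.1.ofLp ⬝ᵥ (P *ᵥ δ.2.1.ofLp))

theorem residual_add (δ : Constraint 𝒜) (γ : ℝ) (P Q : Matrix (Fin n) (Fin n) ℝ) :
    residual δ γ (P + Q) = residual δ γ P + residual δ γ Q := by
  simp only [residual, add_mulVec, dotProduct_add]
  ring

theorem residual_smul (δ : Constraint 𝒜) (γ a : ℝ) (P : Matrix (Fin n) (Fin n) ℝ) :
    residual δ γ (a • P) = a * residual δ γ P := by
  simp only [residual, smul_mulVec, dotProduct_smul, smul_eq_mul]
  ring

theorem continuous_residual {Y : Type*} [TopologicalSpace Y] {δ : Y → Constraint 𝒜} {γ : Y → ℝ}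
    {P : Y → Matrix (Fin n) (Fin n) ℝ} (hδ : Continuous δ) (hγ : Continuous γ)
    (hP : Continuous P) : Continuous fun y => residual (δ y) (γ y) (P y) := by
  unfold residual
  fun_prop

theorem mem_feasible_iff {ω : Set (Constraint 𝒜)} {q : ℝ × Matrix (Fin n) (Fin n) ℝ} :
    q ∈ feasible 𝒜 C ω ↔
      0 ≤ q.1 ∧ q.2 ∈ commonSet n C ∧ ∀ δ ∈ ω, residual δ q.1 q.2 ≤ 0 := by
  simp only [feasible, residual, sub_nonpos]
  rfl

theorem feasible_anti {ω ω' : Set (Constraint 𝒜)} (h : ω' ⊆ ω) :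
    feasible 𝒜 C ω ⊆ feasible 𝒜 C ω' :=
  fun _ hq => ⟨hq.1, hq.2.1, fun δ hδ => hq.2.2 δ (h hδ)⟩

/-- The common constraint, rescaled by `s`. The union over `s > 0` is the convex cone generated by
the common set. -/
def scaledCommonSet (n : ℕ) (C s : ℝ) : Set (Matrix (Fin n) (Fin n) ℝ) :=
  {P | P.IsSymm ∧ (P - s • 1).PosSemidef ∧ ‖P‖ ≤ s * C}

theorem scaledCommonSet_one : scaledCommonSet n C 1 = commonSet n C := by
  simp [scaledCommonSet, commonSet]

theorem add_mem_scaledCommonSet {s t : ℝ} {P Q : Matrix (Fin n) (Fin n) ℝ}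
    (hP : P ∈ scaledCommonSet n C s) (hQ : Q ∈ scaledCommonSet n C t) :
    P + Q ∈ scaledCommonSet n C (s + t) := by
  refine ⟨hP.1.add hQ.1, ?_, (norm_add_le _ _).trans ?_⟩
  · have := hP.2.1.add hQ.2.1
    rwa [sub_add_sub_comm, ← add_smul] at this
  · rw [add_mul]
    exact add_le_add hP.2.2 hQ.2.2

theorem smul_mem_scaledCommonSet {s a : ℝ} (ha : 0 ≤ a) {P : Matrix (Fin n) (Fin n) ℝ}
    (hP : P ∈ scaledCommonSet n C s) : a • P ∈ scaledCommonSet n C (a * s) := by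
  refine ⟨hP.1.smul a, ?_, ?_⟩
  · have := hP.2.1.smul ha
    rwa [smul_sub, smul_smul] at this
  · rw [norm_smul, Real.norm_of_nonneg ha, mul_assoc]
    exact mul_le_mul_of_nonneg_left hP.2.2 ha

theorem convex_mem_commonSet {t : ℝ} (h₀ : 0 ≤ t) (h₁ : t ≤ 1) {P Q : Matrix (Fin n) (Fin n) ℝ}
    (hP : P ∈ commonSet n C) (hQ : Q ∈ commonSet n C) :
    (1 - t) • P + t • Q ∈ commonSet n C := by
  rw [← scaledCommonSet_one] at *
  have := add_mem_scaledCommonSet (smul_mem_scaledCommonSet (sub_nonneg.2 h₁) hP)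
    (smul_mem_scaledCommonSet h₀ hQ)
  simpa using this

theorem dotProduct_self_sphere (x : UnitSphere n) : x.1.ofLp ⬝ᵥ x.1.ofLp = 1 := by
  have h := x.2
  rw [mem_sphere_zero_iff_norm, EuclideanSpace.norm_eq, Real.sqrt_eq_one] at h
  simpa [dotProduct, sq] using h

theorem le_quadForm_of_mem {s : ℝ} {P : Matrix (Fin n) (Fin n) ℝ}
    (hP : P ∈ scaledCommonSet n C s) (v : Fin n → ℝ) : s * (v ⬝ᵥ v) ≤ v ⬝ᵥ (P *ᵥ v) := by
  have h := hP.2.1.dotProduct_mulVec_nonneg v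
  simpa [sub_mulVec, smul_mulVec, dotProduct_sub] using h

theorem posDef_of_mem {P : Matrix (Fin n) (Fin n) ℝ} (hP : P ∈ commonSet n C) : P.PosDef := by
  have := PosDef.posSemidef_add hP.2.1 PosDef.one
  rwa [sub_add_cancel] at this

theorem residual_lt_of_lt {P : Matrix (Fin n) (Fin n) ℝ} (hP : P ∈ commonSet n C)
    (δ : Constraint 𝒜) {γ γ' : ℝ} (h₀ : 0 ≤ γ') (h : γ' < γ) :
    residual δ γ P < residual δ γ' P := by
  have h1 := le_quadForm_of_mem (scaledCommonSet_one (n := n) ▸ hP) δ.2.1.ofLp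
  rw [dotProduct_self_sphere] at h1
  have h2 : γ' ^ 2 < γ ^ 2 := by gcongr
  unfold residual
  nlinarith

/-- `q = (γ, P)` is an optimal solution of the problem with the constraints `ω`. -/
def IsSol (𝒜 : Finset (Matrix (Fin n) (Fin n) ℝ)) (C : ℝ) (ω : Set (Constraint 𝒜))
    (q : ℝ × Matrix (Fin n) (Fin n) ℝ) : Prop :=
  q ∈ feasible 𝒜 C ω ∧ ∀ q' ∈ feasible 𝒜 C ω, objective q ≤ objective q'

theorem exists_isSol (hC : (n : ℝ) ≤ C) {ω : Set (Constraint 𝒜)} (hω : ω.Finite) :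
    ∃ q, IsSol 𝒜 C ω q := by
  obtain ⟨⟨q, hq, h1⟩, h2⟩ := isLeast_cost 𝒜 C hC ω hω
  exact ⟨q, hq, fun q' hq' => h1 ▸ h2 ⟨q', hq', rfl⟩⟩

theorem IsSol.objective_eq_cost (hC : (n : ℝ) ≤ C) {ω : Set (Constraint 𝒜)} (hω : ω.Finite)
    {q : ℝ × Matrix (Fin n) (Fin n) ℝ} (hq : IsSol 𝒜 C ω q) : objective q = cost 𝒜 C ω := by
  obtain ⟨⟨q', hq', h1⟩, h2⟩ := isLeast_cost 𝒜 C hC ω hω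
  exact le_antisymm (h1 ▸ hq.2 q' hq') (h2 ⟨q, hq.1, rfl⟩)

theorem objective_lt_iff {q q' : ℝ × Matrix (Fin n) (Fin n) ℝ} :
    objective q < objective q' ↔ q.1 < q'.1 ∨ q.1 = q'.1 ∧ ‖q.2‖ < ‖q'.2‖ := by
  rw [objective, objective, Prod.Lex.toLex_lt_toLex]
  simp [sq_lt_sq₀]

theorem frobenius_sq (P : Matrix (Fin n) (Fin n) ℝ) : ‖P‖ ^ 2 = ∑ i, ∑ j, P i j ^ 2 := by
  rw [frobenius_norm_def, ← Real.sqrt_eq_rpow, Real.sq_sqrt (by positivity)]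
  simp

theorem frobenius_midpoint (P Q : Matrix (Fin n) (Fin n) ℝ) :
    ‖(1 / 2 : ℝ) • P + (1 / 2 : ℝ) • Q‖ ^ 2 + ‖P - Q‖ ^ 2 / 4 = (‖P‖ ^ 2 + ‖Q‖ ^ 2) / 2 := by
  simp only [frobenius_sq, Matrix.add_apply, Matrix.smul_apply, Matrix.sub_apply, smul_eq_mul,
    Finset.sum_div, ← Finset.sum_add_distrib]
  refine Finset.sum_congr rfl fun i _ => Finset.sum_congr rfl fun j _ => ?_
  ring

/-- The optimal solution is unique, since the Frobenius norm is strictly convex. -/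
theorem IsSol.unique {ω : Set (Constraint 𝒜)} {q q' : ℝ × Matrix (Fin n) (Fin n) ℝ}
    (hq : IsSol 𝒜 C ω q) (hq' : IsSol 𝒜 C ω q') : q = q' := by
  have heq : objective q = objective q' := le_antisymm (hq.2 q' hq'.1) (hq'.2 q hq.1)
  have h1 : q.1 = q'.1 := congrArg (fun c => (ofLex c).1) heq
  have h2 : ‖q.2‖ ^ 2 = ‖q'.2‖ ^ 2 := congrArg (fun c => (ofLex c).2) heq
  -- the midpoint has the same `γ`, and a smaller norm unless the two matrices agree
  set M := (1 / 2 : ℝ) • q.2 + (1 / 2 : ℝ) • q'.2 with hM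
  have hmem : (q.1, M) ∈ feasible 𝒜 C ω := by
    have hf := mem_feasible_iff.1 hq.1
    have hf' := mem_feasible_iff.1 hq'.1
    refine mem_feasible_iff.2 ⟨hf.1, ?_, fun δ hδ => ?_⟩
    · have := convex_mem_commonSet (t := 1 / 2) (by norm_num) (by norm_num) hf.2.1 hf'.2.1
      norm_num at this
      norm_num [hM]
      exact this
    · have a1 := hf.2.2 δ hδ
      have a2 := hf'.2.2 δ hδ
      rw [← h1] at a2
      simp only [hM, residual_add, residual_smul]
      linarith
  have h3 : ‖q.2‖ ≤ ‖M‖ := by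
    by_contra! h
    exact (hq.2 _ hmem).not_gt (objective_lt_iff.2 (Or.inr ⟨rfl, h⟩))
  have h4 := frobenius_midpoint q.2 q'.2
  rw [← hM] at h4
  have h5 : ‖q.2‖ ^ 2 ≤ ‖M‖ ^ 2 := by gcongr
  have h6 : ‖q.2 - q'.2‖ = 0 := by
    rw [← sq_eq_zero_iff]
    refine le_antisymm ?_ (sq_nonneg _)
    linarith
  exact Prod.ext h1 (sub_eq_zero.1 (norm_eq_zero.1 h6))

/-- The matrix `P` shows that `q = (γ, ·)` is not optimal: either all constraints hold strictly
at `(γ, P)`, so that `γ` can be decreased, or they hold and `P` has smaller norm. -/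
def Improves (C : ℝ) (ω : Set (Constraint 𝒜)) (q : ℝ × Matrix (Fin n) (Fin n) ℝ)
    (P : Matrix (Fin n) (Fin n) ℝ) : Prop :=
  P ∈ commonSet n C ∧ ((0 < q.1 ∧ ∀ δ ∈ ω, residual δ q.1 P < 0) ∨
    (∀ δ ∈ ω, residual δ q.1 P ≤ 0) ∧ ‖P‖ < ‖q.2‖)

/-- Optimality can be tested at the optimal value of `γ` alone. -/
theorem isSol_iff {ω : Set (Constraint 𝒜)} (hω : ω.Finite)
    {q : ℝ × Matrix (Fin n) (Fin n) ℝ} :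
    IsSol 𝒜 C ω q ↔ q ∈ feasible 𝒜 C ω ∧ ∀ P, ¬ Improves C ω q P := by
  refine and_congr_right fun hq => ⟨fun h P hP => ?_, fun h q' hq' => ?_⟩
  · obtain ⟨hPc, ⟨hγ, hneg⟩ | ⟨hle, hnorm⟩⟩ := hP
    · have hev : ∀ᶠ γ in nhds q.1, 0 < γ ∧ ∀ δ ∈ ω, residual δ γ P < 0 := by
        refine (lt_mem_nhds hγ).and ((Filter.eventually_all_finite hω).2 fun δ hδ => ?_)
        have hc : Continuous fun γ : ℝ => residual δ γ P :=
          continuous_residual continuous_const continuous_id continuous_const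
        exact (hc.tendsto q.1).eventually_lt_const (hneg δ hδ)
      obtain ⟨γ, hγ1, hγ2⟩ := ((hev.filter_mono nhdsWithin_le_nhds).and
        (self_mem_nhdsWithin (s := Set.Iio q.1))).exists
      exact (h (γ, P) (mem_feasible_iff.2 ⟨hγ1.1.le, hPc, fun δ hδ => (hγ1.2 δ hδ).le⟩)).not_gt
        (objective_lt_iff.2 (Or.inl hγ2))
    · exact (h (q.1, P) (mem_feasible_iff.2 ⟨hq.1, hPc, hle⟩)).not_gt
        (objective_lt_iff.2 (Or.inr ⟨rfl, hnorm⟩))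
  · by_contra! hlt
    have hf := mem_feasible_iff.1 hq'
    refine h q'.2 ⟨hf.2.1, ?_⟩
    rcases objective_lt_iff.1 hlt with h1 | ⟨h1, h2⟩
    · exact Or.inl ⟨hf.1.trans_lt h1, fun δ hδ =>
        (residual_lt_of_lt hf.2.1 δ hf.1 h1).trans_le (hf.2.2 δ hδ)⟩
    · exact Or.inr ⟨h1 ▸ hf.2.2, h2⟩

theorem IsSol.mono {ω ω' : Set (Constraint 𝒜)} {q : ℝ × Matrix (Fin n) (Fin n) ℝ}
    (hq : IsSol 𝒜 C ω' q) (h : ω' ⊆ ω) (hf : ∀ δ ∈ ω, residual δ q.1 q.2 ≤ 0) : IsSol 𝒜 C ω q :=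
  ⟨mem_feasible_iff.2 ⟨hq.1.1, hq.1.2.1, hf⟩, fun q' hq' => hq.2 q' (feasible_anti h hq')⟩

/-- Inactive constraints can be removed without changing the optimal solution. -/
theorem IsSol.of_inactive {ω ω' : Set (Constraint 𝒜)} (hω : ω.Finite)
    {q : ℝ × Matrix (Fin n) (Fin n) ℝ} (hq : IsSol 𝒜 C ω q) (h : ω' ⊆ ω)
    (hin : ∀ δ ∈ ω, δ ∉ ω' → residual δ q.1 q.2 < 0) : IsSol 𝒜 C ω' q := by
  refine (isSol_iff (hω.subset h)).2 ⟨feasible_anti h hq.1, fun P hP => ?_⟩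
  have hf := mem_feasible_iff.1 hq.1
  -- move a little from the optimal matrix towards `P`, keeping the inactive constraints inactive
  have hev : ∀ᶠ t in nhds (0 : ℝ), t < 1 ∧ ∀ δ ∈ ω, δ ∉ ω' →
      residual δ q.1 ((1 - t) • q.2 + t • P) < 0 := by
    refine (gt_mem_nhds zero_lt_one).and ((Filter.eventually_all_finite hω).2 fun δ hδ => ?_)
    by_cases hδ' : δ ∈ ω'
    · exact Filter.Eventually.of_forall fun _ h => absurd hδ' h
    have hc : Continuous fun t : ℝ => residual δ q.1 ((1 - t) • q.2 + t • P) :=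
      continuous_residual continuous_const continuous_const (by fun_prop)
    have h0 : residual δ q.1 ((1 - 0 : ℝ) • q.2 + (0 : ℝ) • P) < 0 := by
      simpa using hin δ hδ hδ'
    exact ((hc.tendsto 0).eventually_lt_const h0).mono fun t ht _ => ht
  obtain ⟨t, ⟨ht1, htin⟩, ht0⟩ := ((hev.filter_mono nhdsWithin_le_nhds).and
    (self_mem_nhdsWithin (s := Set.Ioi (0 : ℝ)))).exists
  have ht0 : 0 < t := ht0
  refine ((isSol_iff hω).1 hq).2 ((1 - t) • q.2 + t • P)
    ⟨convex_mem_commonSet ht0.le ht1.le hf.2.1 hP.1, ?_⟩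
  have hcomb : ∀ δ : Constraint 𝒜, residual δ q.1 ((1 - t) • q.2 + t • P) =
      (1 - t) * residual δ q.1 q.2 + t * residual δ q.1 P := fun δ => by
    rw [residual_add, residual_smul, residual_smul]
  rcases hP.2 with ⟨hγ, hneg⟩ | ⟨hle, hnorm⟩
  · refine Or.inl ⟨hγ, fun δ hδ => ?_⟩
    by_cases hδ' : δ ∈ ω'
    · rw [hcomb]
      nlinarith [hneg δ hδ', hf.2.2 δ hδ]
    · exact htin δ hδ hδ'
  · refine Or.inr ⟨fun δ hδ => ?_, ?_⟩
    · by_cases hδ' : δ ∈ ω'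
      · rw [hcomb]
        nlinarith [hle δ hδ', hf.2.2 δ hδ]
      · exact (htin δ hδ hδ').le
    · refine (norm_add_le _ _).trans_lt ?_
      rw [norm_smul, norm_smul, Real.norm_of_nonneg ht0.le, Real.norm_of_nonneg (by linarith)]
      nlinarith

/-- The symmetric matrix with entries given by a function on unordered pairs of indices. -/
def symMatrix (n : ℕ) : (Sym2 (Fin n) → ℝ) →ₗ[ℝ] Matrix (Fin n) (Fin n) ℝ where
  toFun f := Matrix.of fun i j => f s(i, j)
  map_add' _ _ := rfl
  map_smul' _ _ := rfl

theorem exists_symMatrix_eq {P : Matrix (Fin n) (Fin n) ℝ} (hP : P.IsSymm) :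
    ∃ f, symMatrix n f = P :=
  ⟨fun z => Sym2.lift ⟨fun i j => P i j, fun i j => (hP.apply j i)⟩ z, by ext i j; rfl⟩

theorem finrank_sym2 (n : ℕ) :
    Module.finrank ℝ (Sym2 (Fin n) → ℝ) = n * (n + 1) / 2 := by
  rw [Module.finrank_fintype_fun_eq_card, Sym2.card, Fintype.card_fin, Nat.choose_two_right,
    Nat.add_sub_cancel, mul_comm]

/-- The matrices that certify, up to scaling, an improvement on `q` for the single constraint
`δ`. They form a convex cone. -/
def improvingCone (C : ℝ) (q : ℝ × Matrix (Fin n) (Fin n) ℝ) (δ : Constraint 𝒜) :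
    Set (Matrix (Fin n) (Fin n) ℝ) :=
  {P | ∃ s > 0, P ∈ scaledCommonSet n C s ∧ residual δ q.1 P ≤ 0 ∧
    (residual δ q.1 P < 0 ∨ ‖P‖ < s * ‖q.2‖)}

theorem add_mem_improvingCone {q : ℝ × Matrix (Fin n) (Fin n) ℝ} {δ : Constraint 𝒜}
    {P Q : Matrix (Fin n) (Fin n) ℝ} (hP : P ∈ improvingCone C q δ)
    (hQ : Q ∈ improvingCone C q δ) : P + Q ∈ improvingCone C q δ := by
  obtain ⟨s, hs, hP1, hP2, hP3⟩ := hP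
  obtain ⟨t, ht, hQ1, hQ2, hQ3⟩ := hQ
  refine ⟨s + t, add_pos hs ht, add_mem_scaledCommonSet hP1 hQ1, ?_, ?_⟩
  · rw [residual_add]; linarith
  · rw [residual_add]
    rcases hP3 with h | h
    · exact Or.inl (by linarith)
    rcases hQ3 with h' | h'
    · exact Or.inl (by linarith)
    · exact Or.inr ((norm_add_le _ _).trans_lt (by linarith))

theorem smul_mem_improvingCone {q : ℝ × Matrix (Fin n) (Fin n) ℝ} {δ : Constraint 𝒜}
    {P : Matrix (Fin n) (Fin n) ℝ} (hP : P ∈ improvingCone C q δ) {a : ℝ} (ha : 0 < a) :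
    a • P ∈ improvingCone C q δ := by
  obtain ⟨s, hs, hP1, hP2, hP3⟩ := hP
  refine ⟨a * s, mul_pos ha hs, smul_mem_scaledCommonSet ha.le hP1, ?_, ?_⟩
  · rw [residual_smul]; nlinarith
  · rw [residual_smul, norm_smul, Real.norm_of_nonneg ha.le, mul_assoc]
    exact hP3.imp (fun h => by nlinarith) fun h => by gcongr

theorem trace_pos_of_mem {s : ℝ} (hn : 1 ≤ n) (hs : 0 < s) {P : Matrix (Fin n) (Fin n) ℝ}
    (hP : P ∈ scaledCommonSet n C s) : 0 < P.trace := by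
  have h := hP.2.1.trace_nonneg
  rw [trace_sub, trace_smul, trace_one, Fintype.card_fin, smul_eq_mul, sub_nonneg] at h
  have hn' : (0 : ℝ) < n := by exact_mod_cast hn
  exact (mul_pos hs hn').trans_le h

/-- A common element of the improving cones improves on `q` for all constraints, after rescaling by
the largest of the scales. -/
theorem exists_improves {ι : Type*} [Fintype ι] [Nonempty ι] {v : ι → Constraint 𝒜}
    {q : ℝ × Matrix (Fin n) (Fin n) ℝ} (hq : 0 ≤ q.1) {P : Matrix (Fin n) (Fin n) ℝ}
    (hP : ∀ i, P ∈ improvingCone C q (v i)) : ∃ Q, Improves C (Set.range v) q Q := by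
  choose s hs h1 h2 h3 using hP
  obtain ⟨k, hk⟩ := Finite.exists_max s
  have hinv := inv_pos.2 (hs k)
  refine ⟨(s k)⁻¹ • P, ?_, ?_⟩
  · have := smul_mem_scaledCommonSet hinv.le (h1 k)
    rwa [inv_mul_cancel₀ (hs k).ne', scaledCommonSet_one] at this
  simp only [Set.forall_mem_range, residual_smul]
  -- if all residuals are negative, then `γ ≠ 0`, because the residuals at `γ = 0` are nonnegative
  by_cases hall : ∀ i, residual (v i) q.1 P < 0
  · refine Or.inl ⟨hq.lt_of_ne fun h0 => ?_, fun i => mul_neg_of_pos_of_neg hinv (hall i)⟩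
    have h4 := hall k
    have h5 := le_quadForm_of_mem (h1 k) ((v k).1.1 *ᵥ (v k).2.1.ofLp)
    have h6 : 0 ≤ ((v k).1.1 *ᵥ (v k).2.1.ofLp) ⬝ᵥ ((v k).1.1 *ᵥ (v k).2.1.ofLp) := by
      simpa using dotProduct_star_self_nonneg ((v k).1.1 *ᵥ (v k).2.1.ofLp)
    have h7 := mul_nonneg (hs k).le h6
    rw [residual, ← h0] at h4
    linarith
  · push Not at hall
    obtain ⟨i, hi⟩ := hall
    refine Or.inr ⟨fun j => mul_nonpos_of_nonneg_of_nonpos hinv.le (h2 j), ?_⟩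
    have h4 : ‖P‖ < s i * ‖q.2‖ := (h3 i).resolve_left hi.not_gt
    have h5 : s i * ‖q.2‖ ≤ s k * ‖q.2‖ := by gcongr; exact hk i
    rw [norm_smul, Real.norm_of_nonneg hinv.le, inv_mul_lt_iff₀ (hs k)]
    exact h4.trans_le h5

/-- The optimal solution is determined by at most `n(n+1)/2` of the constraints. The problem has
`n(n+1)/2 + 1` variables, but the improving cones are cones, which saves one dimension in Helly's
theorem. -/
theorem IsSol.exists_basis (hn : 1 ≤ n) {ι : Type*} [Fintype ι] {v : ι → Constraint 𝒜}
    {q : ℝ × Matrix (Fin n) (Fin n) ℝ} (hq : IsSol 𝒜 C (Set.range v) q) :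
    ∃ I : Finset ι, I.card ≤ n * (n + 1) / 2 ∧ IsSol 𝒜 C (v '' I) q := by
  rcases isEmpty_or_nonempty ι with hι | hι
  · refine ⟨∅, by simp, ?_⟩
    rw [Set.range_eq_empty] at hq
    simpa using hq
  by_contra! hcon
  have hℓ : (traceLinearMap (Fin n) ℝ ℝ).comp (symMatrix n) ≠ 0 := by
    intro h
    obtain ⟨f, hf⟩ := exists_symMatrix_eq (isSymm_one (n := Fin n) (α := ℝ))
    have := LinearMap.congr_fun h f
    simp [hf] at this
    omega
  obtain ⟨f, hf⟩ := helly_cone hℓ Finset.univ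
    (fun i => {f | symMatrix n f ∈ improvingCone C q (v i)})
    (fun i x hx y hy => by
      change symMatrix n (x + y) ∈ improvingCone C q (v i)
      rw [map_add]; exact add_mem_improvingCone hx hy)
    (fun i x hx a ha => by
      change symMatrix n (a • x) ∈ improvingCone C q (v i)
      rw [map_smul]; exact smul_mem_improvingCone hx ha)
    (fun i x ⟨s, hs, hx, _⟩ => trace_pos_of_mem hn hs hx)
    (fun I _ hI => by
      rw [finrank_sym2] at hI
      have h := hcon I hI
      rw [isSol_iff (I.finite_toSet.image v)] at h
      push Not at h
      obtain ⟨P, hP, hP'⟩ := h (feasible_anti (Set.image_subset_range _ _) hq.1)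
      obtain ⟨f, rfl⟩ := exists_symMatrix_eq hP.1
      refine ⟨f, fun i hi => ⟨1, one_pos, scaledCommonSet_one (n := n) ▸ hP, ?_⟩⟩
      have hmem : v i ∈ v '' I := ⟨i, hi, rfl⟩
      rw [one_mul]
      rcases hP' with ⟨_, h⟩ | ⟨h, h'⟩
      · exact ⟨(h _ hmem).le, Or.inl (h _ hmem)⟩
      · exact ⟨h _ hmem, Or.inr h'⟩)
  obtain ⟨Q, hQ⟩ := exists_improves hq.1.1 fun i => hf i (Finset.mem_univ i)
  exact ((isSol_iff (Set.finite_range v)).1 hq).2 Q hQ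

end Program

/-! ### Measurability of the optimal solution -/

section Measurability

open scoped Matrix.Norms.Frobenius

variable {n : ℕ} {𝒜 : Finset (Matrix (Fin n) (Fin n) ℝ)} {C : ℝ}

instance instBorelSpaceModes : BorelSpace {A : Matrix (Fin n) (Fin n) ℝ // A ∈ 𝒜} :=
  ⟨borel_eq_top_of_discrete.symm⟩

open Classical in
/-- The optimal solution of the problem with the constraints `ω`, with junk value `0` if there is
none. -/
noncomputable def sol (𝒜 : Finset (Matrix (Fin n) (Fin n) ℝ)) (C : ℝ) (ω : Set (Constraint 𝒜)) :
    ℝ × Matrix (Fin n) (Fin n) ℝ :=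
  if h : ∃ q, IsSol 𝒜 C ω q then h.choose else 0

theorem isSol_sol (hC : (n : ℝ) ≤ C) {ω : Set (Constraint 𝒜)} (hω : ω.Finite) :
    IsSol 𝒜 C ω (sol 𝒜 C ω) := by
  have h := exists_isSol hC hω
  rw [sol, dif_pos h]
  exact h.choose_spec

theorem IsSol.sol_eq {ω : Set (Constraint 𝒜)} {q : ℝ × Matrix (Fin n) (Fin n) ℝ}
    (hq : IsSol 𝒜 C ω q) : sol 𝒜 C ω = q := by
  have h : ∃ q, IsSol 𝒜 C ω q := ⟨q, hq⟩
  rw [sol, dif_pos h]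
  exact h.choose_spec.unique hq

theorem isClosed_commonSet (n : ℕ) (C : ℝ) : IsClosed (commonSet n C) := by
  have h : commonSet n C =
      (fun P => ((0 : ℝ), P)) ⁻¹' feasible (∅ : Finset (Matrix (Fin n) (Fin n) ℝ)) C ∅ := by
    ext P; simp [feasible]
  rw [h]
  exact (isClosed_feasible _ C ∅).preimage (by fun_prop)

/-- The parameters for which there is a feasible matrix in a closed set and of bounded norm form a
closed set, because the common set is compact. -/
theorem isClosed_setOf_exists {ι : Type*} [Finite ι] {F : Set (Matrix (Fin n) (Fin n) ℝ)}
    (hF : IsClosed F) :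
    IsClosed {y : (ι → Constraint 𝒜) × ℝ × ℝ | ∃ P ∈ commonSet n C, ‖P‖ ≤ y.2.2 ∧
      (∀ i, residual (y.1 i) y.2.1 P ≤ 0) ∧ P ∈ F} := by
  have hprop : ProperSpace (Matrix (Fin n) (Fin n) ℝ) := FiniteDimensional.proper ℝ _
  have hcomp : IsCompact (commonSet n C) :=
    (isCompact_closedBall (0 : Matrix (Fin n) (Fin n) ℝ) C).of_isClosed_subset
      (isClosed_commonSet n C) fun P hP => by simpa using hP.2.2
  have := isCompact_iff_compactSpace.1 hcomp
  have hcl : IsClosed {z : ((ι → Constraint 𝒜) × ℝ × ℝ) × commonSet n C |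
      ‖(z.2 : Matrix (Fin n) (Fin n) ℝ)‖ ≤ z.1.2.2 ∧
        (∀ i, residual (z.1.1 i) z.1.2.1 z.2 ≤ 0) ∧ (z.2 : Matrix (Fin n) (Fin n) ℝ) ∈ F} := by
    have h0 : IsClosed {z : ((ι → Constraint 𝒜) × ℝ × ℝ) × commonSet n C |
        ‖(z.2 : Matrix (Fin n) (Fin n) ℝ)‖ ≤ z.1.2.2} := isClosed_le (by fun_prop) (by fun_prop)
    have h1 : IsClosed {z : ((ι → Constraint 𝒜) × ℝ × ℝ) × commonSet n C |
        (z.2 : Matrix (Fin n) (Fin n) ℝ) ∈ F} :=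
      hF.preimage (by fun_prop : Continuous fun z : ((ι → Constraint 𝒜) × ℝ × ℝ) × commonSet n C =>
        (z.2 : Matrix (Fin n) (Fin n) ℝ))
    have h2 : IsClosed {z : ((ι → Constraint 𝒜) × ℝ × ℝ) × commonSet n C |
        ∀ i, residual (z.1.1 i) z.1.2.1 z.2 ≤ 0} := by
      rw [Set.ofPred_forall]
      exact isClosed_iInter fun i => isClosed_le
        (continuous_residual (by fun_prop) (by fun_prop) (by fun_prop)) continuous_const
    exact h0.inter (h2.inter h1)
  convert isClosedMap_fst_of_compactSpace _ hcl using 1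
  ext y
  constructor
  · rintro ⟨P, hP, h⟩
    exact ⟨(y, ⟨P, hP⟩), h, rfl⟩
  · rintro ⟨⟨y', P⟩, h, rfl⟩
    exact ⟨P, P.2, h⟩

variable {ι : Type*} [Finite ι]

theorem measurable_sol_fst (hC : (n : ℝ) ≤ C) :
    Measurable fun b : ι → Constraint 𝒜 => (sol 𝒜 C (Set.range b)).1 := by
  refine measurable_of_Iic fun c => ?_
  have hcl := (isClosed_setOf_exists (𝒜 := 𝒜) (C := C) (ι := ι) isClosed_univ).preimage
    (by fun_prop : Continuous fun b : ι → Constraint 𝒜 => (b, c, C))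
  rcases lt_or_ge c 0 with hc | hc
  · convert MeasurableSet.empty using 1
    ext b
    have := (isSol_sol hC (Set.finite_range b)).1.1
    simp only [Set.mem_preimage, Set.mem_Iic, Set.mem_empty_iff_false, iff_false, not_le]
    linarith
  convert hcl.measurableSet using 1
  ext b
  have hs := isSol_sol hC (Set.finite_range b)
  have hf := mem_feasible_iff.1 hs.1
  constructor
  · intro h
    have h : (sol 𝒜 C (Set.range b)).1 ≤ c := h
    refine ⟨_, hf.2.1, hf.2.1.2.2, fun i => ?_, trivial⟩
    rcases h.lt_or_eq with h | h
    · exact (residual_lt_of_lt hf.2.1 (b i) hf.1 h).le.trans (hf.2.2 _ ⟨i, rfl⟩)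
    · exact h ▸ hf.2.2 _ ⟨i, rfl⟩
  · rintro ⟨P, hP, -, h, -⟩
    change (sol 𝒜 C (Set.range b)).1 ≤ c
    by_contra! hlt
    refine (hs.2 (c, P) (mem_feasible_iff.2 ⟨hc, hP, ?_⟩)).not_gt (objective_lt_iff.2 (Or.inl hlt))
    rintro _ ⟨i, rfl⟩
    exact h i

/-- The norm of the optimal matrix is a lower semicontinuous function of the sample and of `γ`, and
the optimal `γ` is measurable. -/
theorem measurable_norm_sol_snd (hC : (n : ℝ) ≤ C) :
    Measurable fun b : ι → Constraint 𝒜 => ‖(sol 𝒜 C (Set.range b)).2‖ := by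
  refine measurable_of_Iic fun r => ?_
  have hm : Measurable fun b : ι → Constraint 𝒜 => (b, (sol 𝒜 C (Set.range b)).1, r) :=
    measurable_id.prodMk ((measurable_sol_fst hC).prodMk measurable_const)
  convert hm (isClosed_setOf_exists (C := C) isClosed_univ).measurableSet using 1
  ext b
  have hs := isSol_sol hC (Set.finite_range b)
  have hf := mem_feasible_iff.1 hs.1
  constructor
  · exact fun h => ⟨_, hf.2.1, h, fun i => hf.2.2 _ ⟨i, rfl⟩, trivial⟩
  · rintro ⟨P, hP, hr, h, -⟩
    refine le_trans ?_ hr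
    by_contra! hlt
    refine (hs.2 (_, P) (mem_feasible_iff.2 ⟨hf.1, hP, ?_⟩)).not_gt
      (objective_lt_iff.2 (Or.inr ⟨rfl, hlt⟩))
    rintro _ ⟨i, rfl⟩
    exact h i

/-- The optimal matrix is the only feasible one for the optimal `γ` and of the optimal norm, so that
its entries can be compared with constants by means of `isClosed_setOf_exists`. -/
theorem measurable_sol_snd_apply (hC : (n : ℝ) ≤ C) (k l : Fin n) :
    Measurable fun b : ι → Constraint 𝒜 => (sol 𝒜 C (Set.range b)).2 k l := by
  refine measurable_of_Iic fun c => ?_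
  have hm : Measurable fun b : ι → Constraint 𝒜 =>
      (b, (sol 𝒜 C (Set.range b)).1, ‖(sol 𝒜 C (Set.range b)).2‖) :=
    measurable_id.prodMk ((measurable_sol_fst hC).prodMk (measurable_norm_sol_snd hC))
  have hF : IsClosed {P : Matrix (Fin n) (Fin n) ℝ | P k l ≤ c} :=
    isClosed_le (by fun_prop) continuous_const
  convert hm (isClosed_setOf_exists (C := C) hF).measurableSet using 1
  ext b
  have hs := isSol_sol hC (Set.finite_range b)
  have hf := mem_feasible_iff.1 hs.1
  constructor
  · exact fun h => ⟨_, hf.2.1, le_rfl, fun i => hf.2.2 _ ⟨i, rfl⟩, h⟩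
  · rintro ⟨P, hP, hr, h, hPc⟩
    have hP' : ((sol 𝒜 C (Set.range b)).1, P) ∈ feasible 𝒜 C (Set.range b) := by
      refine mem_feasible_iff.2 ⟨hf.1, hP, ?_⟩
      rintro _ ⟨i, rfl⟩
      exact h i
    have hsol : IsSol 𝒜 C (Set.range b) ((sol 𝒜 C (Set.range b)).1, P) := by
      refine ⟨hP', fun q' hq' => le_trans ?_ (hs.2 q' hq')⟩
      by_contra! hlt
      rcases objective_lt_iff.1 hlt with h | h
      · exact lt_irrefl _ h
      · exact h.2.not_ge hr
    change (sol 𝒜 C (Set.range b)).2 k l ≤ c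
    rw [hs.unique hsol]
    exact hPc

theorem measurable_residual_sol (hC : (n : ℝ) ≤ C) :
    Measurable fun p : (ι → Constraint 𝒜) × Constraint 𝒜 =>
      residual p.2 (sol 𝒜 C (Set.range p.1)).1 (sol 𝒜 C (Set.range p.1)).2 := by
  have h1 : Measurable fun p : (ι → Constraint 𝒜) × Constraint 𝒜 =>
      (sol 𝒜 C (Set.range p.1)).1 := (measurable_sol_fst hC).comp measurable_fst
  have h2 : ∀ k l, Measurable fun p : (ι → Constraint 𝒜) × Constraint 𝒜 =>
      (sol 𝒜 C (Set.range p.1)).2 k l :=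
    fun k l => (measurable_sol_snd_apply hC k l).comp measurable_fst
  have h3 : ∀ k, Measurable fun p : (ι → Constraint 𝒜) × Constraint 𝒜 => p.2.2.1.ofLp k :=
    fun k => Continuous.measurable (by fun_prop)
  have h4 : ∀ k l, Measurable fun p : (ι → Constraint 𝒜) × Constraint 𝒜 => p.2.1.1 k l :=
    fun k l => (Measurable.of_discrete (f := fun A : {A // A ∈ 𝒜} => A.1 k l)).comp
      (measurable_fst.comp measurable_snd)
  have h5 : ∀ k, Measurable fun p : (ι → Constraint 𝒜) × Constraint 𝒜 =>
      (p.2.1.1 *ᵥ p.2.2.1.ofLp) k := fun k => by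
    simp only [mulVec, dotProduct]
    exact Finset.measurable_fun_sum _ fun l _ => (h4 k l).mul (h3 l)
  have h6 : ∀ x : (ι → Constraint 𝒜) × Constraint 𝒜 → Fin n → ℝ,
      (∀ k, Measurable fun p => x p k) →
      Measurable fun p => x p ⬝ᵥ ((sol 𝒜 C (Set.range p.1)).2 *ᵥ x p) := fun x hx => by
    simp only [mulVec, dotProduct]
    exact Finset.measurable_fun_sum _ fun k _ => (hx k).mul
      (Finset.measurable_fun_sum _ fun l _ => (h2 k l).mul (hx l))
  exact (h6 _ h5).sub ((h1.pow_const 2).mul (h6 _ h3))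

end Measurability

/-! ### Zero sets of quadratic forms on the sphere -/

section NullSets

variable {n : ℕ} {𝒜 : Finset (Matrix (Fin n) (Fin n) ℝ)} {C : ℝ}

theorem quadForm_add_smul {M : Matrix (Fin n) (Fin n) ℝ} (hM : M.IsSymm) (x y : Fin n → ℝ)
    (t : ℝ) : (x + t • y) ⬝ᵥ (M *ᵥ (x + t • y)) =
      (y ⬝ᵥ (M *ᵥ y)) * t ^ 2 + 2 * (x ⬝ᵥ (M *ᵥ y)) * t + x ⬝ᵥ (M *ᵥ x) := by
  have hsymm : y ⬝ᵥ (M *ᵥ x) = x ⬝ᵥ (M *ᵥ y) := by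
    rw [dotProduct_mulVec, ← mulVec_transpose, hM.eq, dotProduct_comm]
  simp only [mulVec_add, mulVec_smul, dotProduct_add, add_dotProduct, dotProduct_smul,
    smul_dotProduct, smul_eq_mul, hsymm]
  ring

theorem exists_quadForm_ne_zero {M : Matrix (Fin n) (Fin n) ℝ} (hM : M.IsSymm) (h0 : M ≠ 0) :
    ∃ v, v ⬝ᵥ (M *ᵥ v) ≠ 0 := by
  by_contra! h
  refine h0 (Matrix.ext fun i j => ?_)
  have h1 := quadForm_add_smul hM (Pi.single i 1) (Pi.single j 1) 1
  simp only [h] at h1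
  have h2 : (Pi.single i 1 : Fin n → ℝ) ⬝ᵥ (M *ᵥ Pi.single j 1) = M i j := by simp
  rw [h2] at h1
  simpa using h1

/-- The zero set of a nonzero quadratic form is a null set: in the direction of a vector at which
the form does not vanish, each line contains at most two zeros. -/
theorem volume_quadForm_eq_zero {M : Matrix (Fin n) (Fin n) ℝ} (hM : M.IsSymm) (h0 : M ≠ 0) :
    volume {y : EuclideanSpace ℝ (Fin n) | y.ofLp ⬝ᵥ (M *ᵥ y.ofLp) = 0} = 0 := by
  obtain ⟨v, hv⟩ := exists_quadForm_ne_zero hM h0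
  have hmeas : MeasurableSet
      {y : EuclideanSpace ℝ (Fin n) | ¬ y.ofLp ⬝ᵥ (M *ᵥ y.ofLp) = 0} :=
    (isClosed_eq (by fun_prop) continuous_const).measurableSet.compl
  have h := ae_mem_of_ae_add_linearMap_mem
    (LinearMap.toSpanSingleton ℝ (EuclideanSpace ℝ (Fin n)) (WithLp.toLp 2 v)) volume volume
    hmeas ?_
  · rw [ae_iff] at h
    simpa using h
  · intro y
    set p : Polynomial ℝ := Polynomial.C (v ⬝ᵥ (M *ᵥ v)) * Polynomial.X ^ 2 +
      Polynomial.C (2 * (y.ofLp ⬝ᵥ (M *ᵥ v))) * Polynomial.X +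
      Polynomial.C (y.ofLp ⬝ᵥ (M *ᵥ y.ofLp)) with hp
    have hp0 : p ≠ 0 := fun h => hv (by
      have := congrArg (fun r => r.coeff 2) h
      simpa [hp, Polynomial.coeff_X, Polynomial.coeff_C] using this)
    have hfin := (Polynomial.finite_setOfPred_isRoot hp0).measure_zero volume
    rw [ae_iff]
    refine measure_mono_null (fun t ht => ?_) hfin
    have ht : (y.ofLp + t • v) ⬝ᵥ (M *ᵥ (y.ofLp + t • v)) = 0 := by
      simpa using ht
    rw [quadForm_add_smul hM] at ht
    simpa [hp] using ht

theorem sphereUniform_quadForm_eq_zero {M : Matrix (Fin n) (Fin n) ℝ} (hM : M.IsSymm)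
    (h0 : M ≠ 0) :
    sphereUniform n {x : UnitSphere n | x.1.ofLp ⬝ᵥ (M *ᵥ x.1.ofLp) = 0} = 0 := by
  have hmeas : MeasurableSet {x : UnitSphere n | x.1.ofLp ⬝ᵥ (M *ᵥ x.1.ofLp) = 0} :=
    (isClosed_eq (by fun_prop) continuous_const).measurableSet
  refine cond_absolutelyContinuous ?_
  rw [Measure.toSphere_apply' _ hmeas]
  refine mul_eq_zero_of_right _ (measure_mono_null ?_ (volume_quadForm_eq_zero hM h0))
  rintro _ ⟨r, -, _, ⟨x, hx, rfl⟩, rfl⟩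
  have hx : x.1.ofLp ⬝ᵥ (M *ᵥ x.1.ofLp) = 0 := hx
  simp [mulVec_smul, hx]

theorem uniformΔ_quadForm_eq_zero {M : {A // A ∈ 𝒜} → Matrix (Fin n) (Fin n) ℝ}
    (hM : ∀ A, (M A).IsSymm) (h0 : ∀ A, M A ≠ 0) :
    uniformΔ 𝒜 {δ | δ.2.1.ofLp ⬝ᵥ (M δ.1 *ᵥ δ.2.1.ofLp) = 0} = 0 := by
  have hsf : SFinite (sphereUniform n) := by unfold sphereUniform; infer_instance
  have hmeas : MeasurableSet
      {δ : Constraint 𝒜 | δ.2.1.ofLp ⬝ᵥ (M δ.1 *ᵥ δ.2.1.ofLp) = 0} := by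
    have hMc : Continuous fun δ : Constraint 𝒜 => M δ.1 :=
      (continuous_of_discreteTopology (f := M)).comp continuous_fst
    have hx : Continuous fun δ : Constraint 𝒜 => δ.2.1.ofLp := by fun_prop
    exact (isClosed_eq (hx.dotProduct (hMc.matrix_mulVec hx)) continuous_const).measurableSet
  refine (Measure.measure_prod_null hmeas).2 (Filter.Eventually.of_forall fun A => ?_)
  have h := sphereUniform_quadForm_eq_zero (hM A) (h0 A)
  change sphereUniform n {x : UnitSphere n | x.1.ofLp ⬝ᵥ (M A *ᵥ x.1.ofLp) = 0} = 0
  exact h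

theorem residual_eq_quadForm (δ : Constraint 𝒜) (γ : ℝ) (P : Matrix (Fin n) (Fin n) ℝ) :
    residual δ γ P =
      δ.2.1.ofLp ⬝ᵥ ((δ.1.1ᵀ * P * δ.1.1 - γ ^ 2 • P) *ᵥ δ.2.1.ofLp) := by
  rw [residual, sub_mulVec, dotProduct_sub, smul_mulVec, dotProduct_smul, smul_eq_mul,
    ← mulVec_mulVec, ← mulVec_mulVec, dotProduct_mulVec _ δ.1.1ᵀ, vecMul_transpose]

/-- If no matrix is Barabanov, a random constraint is almost surely not active at a given point. -/
theorem uniformΔ_residual_eq_zero (hB : ∀ A ∈ 𝒜, ¬ IsBarabanov A) {γ : ℝ} (hγ : 0 ≤ γ)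
    {P : Matrix (Fin n) (Fin n) ℝ} (hP : P.PosDef) :
    uniformΔ 𝒜 {δ | residual δ γ P = 0} = 0 := by
  simp only [residual_eq_quadForm]
  have hPs : P.IsSymm := hP.1
  refine uniformΔ_quadForm_eq_zero (M := fun A => A.1ᵀ * P * A.1 - γ ^ 2 • P)
    (fun A => IsSymm.sub ?_ (hPs.smul _)) fun A h => hB A.1 A.2 ⟨P, hP, γ, hγ, sub_eq_zero.1 h⟩
  rw [IsSymm, transpose_mul, transpose_mul, transpose_transpose, hPs.eq, Matrix.mul_assoc]

/-- In dimension at most one every matrix `A` is Barabanov, with `P = 1` and `γ = |tr A|`. -/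
theorem two_le_of_not_isBarabanov {A : Matrix (Fin n) (Fin n) ℝ} (hA : ¬ IsBarabanov A) :
    2 ≤ n := by
  by_contra! hn
  have hsub : Subsingleton (Fin n) := Fin.subsingleton_iff_le_one.2 (by omega)
  refine hA ⟨1, PosDef.one, |A.trace|, abs_nonneg _, ?_⟩
  ext i j
  obtain rfl := Subsingleton.elim i j
  have hu : (Finset.univ : Finset (Fin n)) = {i} := by
    ext k; simp [Subsingleton.elim k i]
  simp [Matrix.mul_apply, hu, trace, sq]

/-- The square of the `i`-th coordinate of the sphere component has no atoms when `n ≥ 2`. -/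
theorem uniformΔ_coord_sq_eq (hn : 2 ≤ n) (i : Fin n) (c : ℝ) :
    uniformΔ 𝒜 {δ | δ.2.1.ofLp i ^ 2 = c} = 0 := by
  have hdiag : (diagonal (fun k => if k = i then 1 - c else -c) : Matrix (Fin n) (Fin n) ℝ) ≠ 0 := by
    intro h
    have : Nontrivial (Fin n) := Fin.nontrivial_iff_two_le.2 hn
    obtain ⟨j, hj⟩ := exists_ne i
    have h1 := congrFun (congrFun h i) i
    have h2 := congrFun (congrFun h j) j
    simp [hj] at h1 h2
    linarith
  -- on the sphere, `xᵢ² = c` is the equation `xᵢ² - c |x|² = 0`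
  refine measure_mono_null (fun δ hδ => ?_)
    (uniformΔ_quadForm_eq_zero (fun _ => isSymm_diagonal _) fun _ => hdiag)
  have hδ : δ.2.1.ofLp i ^ 2 = c := hδ
  have h1 := dotProduct_self_sphere δ.2
  have h2 : ∀ k, δ.2.1.ofLp k * ((if k = i then 1 - c else -c) * δ.2.1.ofLp k) =
      (if k = i then δ.2.1.ofLp k ^ 2 else 0) - c * (δ.2.1.ofLp k * δ.2.1.ofLp k) := by
    intro k; split_ifs <;> ring
  change δ.2.1.ofLp ⬝ᵥ (diagonal _ *ᵥ δ.2.1.ofLp) = 0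
  simp only [dotProduct, mulVec_diagonal, h2, Finset.sum_sub_distrib, ← Finset.mul_sum]
  simp only [dotProduct] at h1
  rw [h1]
  simp [hδ]

end NullSets

/-! ### The selected subset of the constraints -/

section Selection

open scoped Matrix.Norms.Frobenius

variable {n : ℕ} {𝒜 : Finset (Matrix (Fin n) (Fin n) ℝ)} {C : ℝ}

/-- The relation between a tuple `b` of constraints and a further constraint `δ` which says that
`δ` changes neither the optimal solution of `b` nor the completion of the active constraints of
`b` to a `d`-element set: `δ` is inactive, and it has a larger tag than the inactive elements
of `b`. -/
def undisturbed (C : ℝ) (tag : Constraint 𝒜 → ℝ) (d : ℕ) :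
    Set ((Fin d → Constraint 𝒜) × Constraint 𝒜) :=
  {p | residual p.2 (sol 𝒜 C (Set.range p.1)).1 (sol 𝒜 C (Set.range p.1)).2 < 0 ∧
    ∀ i, residual (p.1 i) (sol 𝒜 C (Set.range p.1)).1 (sol 𝒜 C (Set.range p.1)).2 = 0 ∨
      tag (p.1 i) < tag p.2}

theorem measurableSet_undisturbed (hC : (n : ℝ) ≤ C) {tag : Constraint 𝒜 → ℝ}
    (htag : Measurable tag) (d : ℕ) : MeasurableSet (undisturbed C tag d) := by
  have h1 := measurable_residual_sol (𝒜 := 𝒜) (ι := Fin d) hC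
  have h2 : ∀ i, Measurable fun p : (Fin d → Constraint 𝒜) × Constraint 𝒜 => (p.1, p.1 i) :=
    fun i => by fun_prop
  have h3 : ∀ i, Measurable fun p : (Fin d → Constraint 𝒜) × Constraint 𝒜 => p.1 i :=
    fun i => by fun_prop
  have h4 : MeasurableSet {p : (Fin d → Constraint 𝒜) × Constraint 𝒜 | ∀ i,
      residual (p.1 i) (sol 𝒜 C (Set.range p.1)).1 (sol 𝒜 C (Set.range p.1)).2 = 0 ∨
        tag (p.1 i) < tag p.2} := by
    rw [Set.ofPred_forall]
    exact MeasurableSet.iInter fun i =>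
      (measurableSet_eq_fun (h1.comp (h2 i)) measurable_const).union
        (measurableSet_lt (htag.comp (h3 i)) (htag.comp measurable_snd))
  exact (measurableSet_lt h1 measurable_const).inter h4

theorem selected_undisturbed_iff {tag : Constraint 𝒜 → ℝ} {d N : ℕ} {ω : Fin N → Constraint 𝒜}
    {I : Finset (Fin N)} (hI : I.card = d) :
    Selected (undisturbed C tag d) ω I hI ↔ ∀ j ∉ I,
      residual (ω j) (sol 𝒜 C (ω '' I)).1 (sol 𝒜 C (ω '' I)).2 < 0 ∧
      ∀ i ∈ I, residual (ω i) (sol 𝒜 C (ω '' I)).1 (sol 𝒜 C (ω '' I)).2 = 0 ∨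
        tag (ω i) < tag (ω j) := by
  have hr : Set.range (ω ∘ I.orderEmbOfFin hI) = ω '' I := by
    rw [Set.range_comp, Finset.range_orderEmbOfFin]
  refine forall₂_congr fun j _ => and_congr (by rw [hr]) ?_
  simp only [hr]
  refine ⟨fun h i hi => ?_, fun h i => h _ (I.orderEmbOfFin_mem hI i)⟩
  rw [← Finset.mem_coe, ← Finset.range_orderEmbOfFin I hI] at hi
  obtain ⟨k, rfl⟩ := hi
  exact h k

/-- A selected subset determines the optimal solution of the whole sample. -/
theorem isSol_range_of_selected (hC : (n : ℝ) ≤ C) {tag : Constraint 𝒜 → ℝ} {d N : ℕ}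
    {ω : Fin N → Constraint 𝒜} {I : Finset (Fin N)} {hI : I.card = d}
    (h : Selected (undisturbed C tag d) ω I hI) :
    IsSol 𝒜 C (Set.range ω) (sol 𝒜 C (ω '' I)) := by
  have hs := isSol_sol (𝒜 := 𝒜) hC (I.finite_toSet.image ω)
  refine hs.mono (Set.image_subset_range _ _) ?_
  rintro _ ⟨j, rfl⟩
  by_cases hj : j ∈ I
  · exact (mem_feasible_iff.1 hs.1).2.2 _ ⟨j, hj, rfl⟩
  · exact ((selected_undisturbed_iff hI).1 h j hj).1.le

/-- Two selected subsets contain all active constraints; inactive ones in which they differ would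
have tags smaller than each other. -/
theorem selected_unique (hC : (n : ℝ) ≤ C) {tag : Constraint 𝒜 → ℝ} {d N : ℕ}
    (ω : Fin N → Constraint 𝒜) (I J : Finset (Fin N)) (hI : I.card = d) (hJ : J.card = d)
    (hsI : Selected (undisturbed C tag d) ω I hI) (hsJ : Selected (undisturbed C tag d) ω J hJ) :
    I = J := by
  have heq := (isSol_range_of_selected hC hsI).unique (isSol_range_of_selected hC hsJ)
  rw [selected_undisturbed_iff] at hsI hsJ
  by_contra hne
  obtain ⟨i, hiI, hiJ⟩ := Finset.not_subset.1 fun h =>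
    hne (Finset.eq_of_subset_of_card_le h (by rw [hI, hJ]))
  obtain ⟨j, hjJ, hjI⟩ := Finset.not_subset.1 fun h =>
    hne (Finset.eq_of_subset_of_card_le h (by rw [hI, hJ])).symm
  obtain ⟨h1, h2⟩ := hsI j hjI
  obtain ⟨h3, h4⟩ := hsJ i hiJ
  rw [heq] at h1 h2
  exact lt_asymm ((h2 i hiI).resolve_left h3.ne) ((h4 j hjJ).resolve_left h1.ne)

/-- In general position, the active constraints together with the inactive ones of smallest tag
form a selected set. -/
theorem exists_selected (hC : (n : ℝ) ≤ C) (hn : 1 ≤ n) {tag : Constraint 𝒜 → ℝ} {N : ℕ}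
    (hN : n * (n + 1) / 2 ≤ N) {ω : Fin N → Constraint 𝒜}
    (htag : ∀ i j, i ≠ j → tag (ω i) ≠ tag (ω j))
    (hgen : ∀ I : Finset (Fin N), ∀ j ∉ I,
      residual (ω j) (sol 𝒜 C (ω '' I)).1 (sol 𝒜 C (ω '' I)).2 ≠ 0) :
    ∃ I, ∃ hI : I.card = n * (n + 1) / 2,
      Selected (undisturbed C tag (n * (n + 1) / 2)) ω I hI := by
  classical
  obtain ⟨z, hz⟩ := exists_isSol (𝒜 := 𝒜) hC (Set.finite_range ω)
  obtain ⟨B, hBcard, hB⟩ := hz.exists_basis hn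
  -- in general position, the active constraints belong to every set that determines the solution
  set act : Finset (Fin N) := {i | residual (ω i) z.1 z.2 = 0} with hact
  have hactB : act ⊆ B := by
    intro i hi
    by_contra hiB
    have := hgen B i hiB
    rw [hB.sol_eq] at this
    exact this (by simpa [hact] using hi)
  obtain ⟨I₀, hI₀, -, hI₀card⟩ := Finset.exists_subsuperset_card_eq (Finset.subset_univ act)
    ((Finset.card_le_card hactB).trans hBcard) (by simpa using hN)
  -- among the `d`-sets containing the active constraints, take one with the smallest sum of tags
  obtain ⟨I, hI, hmin⟩ := Finset.exists_min_image
    ({I | I.card = n * (n + 1) / 2 ∧ act ⊆ I} : Finset (Finset (Fin N)))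
    (fun I => ∑ i ∈ I, tag (ω i)) ⟨I₀, by simp [hI₀, hI₀card]⟩
  obtain ⟨hIcard, hactI⟩ := (Finset.mem_filter_univ _).1 hI
  have hneg : ∀ j ∉ act, residual (ω j) z.1 z.2 < 0 := fun j hj =>
    ((mem_feasible_iff.1 hz.1).2.2 _ ⟨j, rfl⟩).lt_of_ne fun h => hj (by simpa [hact] using h)
  have hsol : sol 𝒜 C (ω '' I) = z := by
    refine (hz.of_inactive (Set.finite_range ω) (Set.image_subset_range _ _) ?_).sol_eq
    rintro _ ⟨j, rfl⟩ hj
    exact hneg j fun h => hj ⟨j, hactI h, rfl⟩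
  refine ⟨I, hIcard, (selected_undisturbed_iff hIcard).2 fun j hj => ?_⟩
  rw [hsol]
  refine ⟨hneg j fun h => hj (hactI h), fun i hi => ?_⟩
  by_contra! hcon
  obtain ⟨hi0, hle⟩ := hcon
  have hij : j ≠ i := fun h => hj (h ▸ hi)
  have hlt : tag (ω j) < tag (ω i) := hle.lt_of_ne (htag j i hij)
  -- exchanging `i` for `j` would decrease the sum of the tags
  have hjI : j ∉ I.erase i := fun h => hj (Finset.mem_of_mem_erase h)
  have h1 := hmin (insert j (I.erase i)) ((Finset.mem_filter_univ _).2 ⟨?_, ?_⟩)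
  · have h2 := Finset.add_sum_erase I (fun i => tag (ω i)) hi
    rw [Finset.sum_insert hjI] at h1
    linarith
  · rw [Finset.card_insert_of_notMem hjI, Finset.card_erase_add_one hi, hIcard]
  · intro k hk
    refine Finset.mem_insert_of_mem (Finset.mem_erase.2 ⟨?_, hactI hk⟩)
    rintro rfl
    exact hi0 (by simpa [hact] using hk)

theorem ae_residual_sol_ne_zero [IsProbabilityMeasure (uniformΔ 𝒜)] (hC : (n : ℝ) ≤ C)
    (hB : ∀ A ∈ 𝒜, ¬ IsBarabanov A) {N : ℕ} (I : Finset (Fin N)) (j : Fin N) (hj : j ∉ I) :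
    ∀ᵐ ω ∂(Measure.pi fun _ : Fin N => uniformΔ 𝒜),
      residual (ω j) (sol 𝒜 C (ω '' I)).1 (sol 𝒜 C (ω '' I)).2 ≠ 0 := by
  have hmp := measurePreserving_pair (uniformΔ 𝒜) (Function.Embedding.subtype (· ∈ I)) j
    (by simpa using hj)
  have hmeas : MeasurableSet {p : ({x // x ∈ I} → Constraint 𝒜) × Constraint 𝒜 |
      residual p.2 (sol 𝒜 C (Set.range p.1)).1 (sol 𝒜 C (Set.range p.1)).2 = 0} :=
    measurableSet_eq_fun (measurable_residual_sol hC) measurable_const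
  have hnull : ((Measure.pi fun _ : {x // x ∈ I} => uniformΔ 𝒜).prod (uniformΔ 𝒜))
      {p | residual p.2 (sol 𝒜 C (Set.range p.1)).1 (sol 𝒜 C (Set.range p.1)).2 = 0} = 0 := by
    rw [Measure.measure_prod_null hmeas]
    refine Filter.Eventually.of_forall fun b => ?_
    have hs := isSol_sol (𝒜 := 𝒜) hC (Set.finite_range b)
    change uniformΔ 𝒜
      {δ | residual δ (sol 𝒜 C (Set.range b)).1 (sol 𝒜 C (Set.range b)).2 = 0} = 0
    exact uniformΔ_residual_eq_zero hB hs.1.1 (posDef_of_mem hs.1.2.1)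
  rw [← hmp.measure_preimage hmeas.nullMeasurableSet] at hnull
  rw [ae_iff]
  convert hnull using 2
  ext ω
  have hr : Set.range (fun i : {x // x ∈ I} => ω (Function.Embedding.subtype (· ∈ I) i)) =
      ω '' I := by
    ext; simp
  simp only [Set.mem_preimage, Set.mem_ofPred_eq, hr, not_not]

theorem ae_tag_ne [IsProbabilityMeasure (uniformΔ 𝒜)] {tag : Constraint 𝒜 → ℝ}
    (htag : Measurable tag) (hatom : ∀ c, uniformΔ 𝒜 {δ | tag δ = c} = 0) {N : ℕ} (i j : Fin N)
    (hij : i ≠ j) :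
    ∀ᵐ ω ∂(Measure.pi fun _ : Fin N => uniformΔ 𝒜), tag (ω i) ≠ tag (ω j) := by
  have hmp := measurePreserving_pair (uniformΔ 𝒜)
    (⟨fun _ => i, Function.injective_of_subsingleton _⟩ : Unit ↪ Fin N) j (by simpa using hij.symm)
  have hmeas : MeasurableSet {p : (Unit → Constraint 𝒜) × Constraint 𝒜 |
      tag p.2 = tag (p.1 ())} :=
    measurableSet_eq_fun (htag.comp (by fun_prop)) (htag.comp (by fun_prop))
  have hnull : ((Measure.pi fun _ : Unit => uniformΔ 𝒜).prod (uniformΔ 𝒜))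
      {p | tag p.2 = tag (p.1 ())} = 0 := by
    rw [Measure.measure_prod_null hmeas]
    refine Filter.Eventually.of_forall fun b => ?_
    change uniformΔ 𝒜 {δ | tag δ = tag (b ())} = 0
    exact hatom _
  rw [← hmp.measure_preimage hmeas.nullMeasurableSet] at hnull
  rw [ae_iff]
  convert hnull using 2
  ext ω
  simp [eq_comm]

/-- A constraint that raises the optimal cost is violated at the optimal solution, and so disturbs
the selected subset. -/
theorem violatingProb_le_of_selected (hC : (n : ℝ) ≤ C) {tag : Constraint 𝒜 → ℝ} {d N : ℕ}
    {ω : Fin N → Constraint 𝒜} {I : Finset (Fin N)} {hI : I.card = d}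
    (h : Selected (undisturbed C tag d) ω I hI) :
    violatingProb 𝒜 C ω ≤
      uniformΔ 𝒜 {δ | (ω ∘ I.orderEmbOfFin hI, δ) ∉ undisturbed C tag d} := by
  have hs := isSol_range_of_selected hC h
  have hr : Set.range (ω ∘ I.orderEmbOfFin hI) = ω '' I := by
    rw [Set.range_comp, Finset.range_orderEmbOfFin]
  refine measure_mono fun δ hδ hmem => ?_
  have hres := hmem.1
  simp only [hr] at hres
  have hs' : IsSol 𝒜 C (Set.range ω ∪ {δ}) (sol 𝒜 C (ω '' I)) := by
    refine hs.mono Set.subset_union_left ?_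
    rintro δ' (hδ' | rfl)
    · exact (mem_feasible_iff.1 hs.1).2.2 δ' hδ'
    · exact hres.le
  have hδ : cost 𝒜 C (Set.range ω) < cost 𝒜 C (Set.range ω ∪ {δ}) := hδ
  rw [← hs.objective_eq_cost hC (Set.finite_range ω),
    ← hs'.objective_eq_cost hC ((Set.finite_range ω).union (Set.finite_singleton δ))] at hδ
  exact lt_irrefl _ hδ

end Selection

end JSR

theorem mainTheorem4 {n : ℕ} (𝒜 : Finset (Matrix (Fin n) (Fin n) ℝ)) (h𝒜 : 𝒜.Nonempty)
    (hBarabanov : ∀ A ∈ 𝒜, ¬ JSR.IsBarabanov A)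
    (C : ℝ) (hC : (n : ℝ) ≤ C)
    (N : ℕ) (hN : n * (n + 1) / 2 ≤ N)
    (ε : ℝ) (hε₀ : 0 < ε) (hε₁ : ε < 1) :
    (Measure.pi fun _ : Fin N => JSR.uniformΔ 𝒜)
        {ω | ENNReal.ofReal ε < JSR.violatingProb 𝒜 C ω} ≤
      ENNReal.ofReal (JSR.Phi ε (n * (n + 1) / 2 - 1) N) ∧
    JSR.Phi ε (n * (n + 1) / 2 - 1) N < JSR.Phi ε (n * (n + 1) / 2) N := by
  obtain ⟨A, hA⟩ := h𝒜
  have hn : 2 ≤ n := JSR.two_le_of_not_isBarabanov (hBarabanov A hA)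
  have hprob := JSR.isProbabilityMeasure_uniformΔ (by omega) 𝒜 ⟨A, hA⟩
  have hd : 1 ≤ n * (n + 1) / 2 := by
    rw [Nat.le_div_iff_mul_le two_pos]
    nlinarith
  constructor
  · let tag : JSR.Constraint 𝒜 → ℝ := fun δ => δ.2.1.ofLp ⟨0, by omega⟩ ^ 2
    have htag : Measurable tag := Continuous.measurable (by fun_prop)
    have hex : ∀ N', n * (n + 1) / 2 ≤ N' →
        ∀ᵐ ω ∂(Measure.pi fun _ : Fin N' => JSR.uniformΔ 𝒜), ∃ I,
          ∃ hI : I.card = n * (n + 1) / 2,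
            JSR.Selected (JSR.undisturbed C tag (n * (n + 1) / 2)) ω I hI := by
      intro N' hN'
      have h1 : ∀ᵐ ω ∂(Measure.pi fun _ : Fin N' => JSR.uniformΔ 𝒜),
          ∀ i j, i ≠ j → tag (ω i) ≠ tag (ω j) := by
        simp only [ae_all_iff, Filter.eventually_imp_distrib_left]
        exact fun i j hij => JSR.ae_tag_ne htag (JSR.uniformΔ_coord_sq_eq hn _) i j hij
      have h2 : ∀ᵐ ω ∂(Measure.pi fun _ : Fin N' => JSR.uniformΔ 𝒜),
          ∀ I : Finset (Fin N'), ∀ j ∉ I, JSR.residual (ω j) (JSR.sol 𝒜 C (ω '' I)).1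
            (JSR.sol 𝒜 C (ω '' I)).2 ≠ 0 := by
        simp only [ae_all_iff, Filter.eventually_imp_distrib_left]
        exact fun I j hj => JSR.ae_residual_sol_ne_zero hC hBarabanov I j hj
      filter_upwards [h1, h2] with ω hω1 hω2
      exact JSR.exists_selected hC (by omega) hN' hω1 hω2
    refine le_trans (measure_mono_ae ?_) (JSR.measure_selected_violation_le (JSR.uniformΔ 𝒜) hd
      (JSR.measurableSet_undisturbed hC htag _) (fun _ => JSR.selected_unique hC) hex hN hε₀ hε₁)
    filter_upwards [hex N hN] with ω hω hV
    obtain ⟨I, hI, hsel⟩ := hω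
    exact ⟨I, hI, hsel, lt_of_lt_of_le hV (JSR.violatingProb_le_of_selected hC hsel)⟩
  · rw [JSR.Phi, JSR.Phi, Nat.sub_add_cancel hd, Finset.sum_range_succ]
    have h1 : 0 < 1 - ε := by linarith
    have h2 : (0 : ℝ) < N.choose (n * (n + 1) / 2) := by exact_mod_cast Nat.choose_pos hN
    have h3 : 0 < (N.choose (n * (n + 1) / 2) : ℝ) * ε ^ (n * (n + 1) / 2) *
        (1 - ε) ^ (N - n * (n + 1) / 2) := by positivity
    linarith
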